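/- Let $n\ge 0$ and let $\alpha_1,\dots,\alpha_n,\beta_1,\dots,\beta_n\in\mathbb C$ satisfy $\alpha_i-\beta_j\notin\mathbb Z$ for all $i,j$. Put $$\mathbf\Gamma(s)=\frac1{\prod_{i=1}^n\Gamma(s-\alpha_i+1)\,\prod_{i=1}^n\Gamma(-s+\beta_i+1)},\qquad D=z\frac{d}{dz},$$ and let $\mathcal H=\mathcal H_{(-1)^n}(\alpha_i,\beta_i)$ be the differential equation $$\Bigl((-1)^n\prod_{i=1}^n(D-\alpha_i)-z\prod_{j=1}^n(D-\beta_j)\Bigr)f=0.$$ Let $A_1,\dots,A_{n_A}$ be the distinct values among $e^{2\pi i\alpha_1},\dots,e^{2\pi i\alpha_n}$, let $m_{A_j}=\#\{k: e^{2\pi i\alpha_k}=A_j\}$, and let $\nu(A_j)$ be the element of minimal real part among the $\alpha_k$ with $e^{2\pi i\alpha_k}=A_j$. Similarly let $B_1,\dots,B_{n_B}$ be the distinct values among the $e^{2\pi i\beta_k}$, with multiplicities $m_{B_j}$, and let $\nu'(B_j)$ be the element of maximal real part among the $\beta_k$ with $e^{2\pi i\beta_k}=B_j$. Put $$S_{A_j,r}(z)=\sum_{l=0}^\infty\Bigl(\frac{\partial}{2\pi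 i\,\partial t}\Bigr)^r\Big|_{t=\nu(A_j)}\bigl(\mathbf\Gamma(l+t)\,z^{l+t}\bigr)\quad(0\le r<m_{A_j}),$$ $$S_{B_j,r}(z)=\sum_{l=0}^\infty\Bigl(\frac{\partial}{2\pi i\,\partial t}\Bigr)^r\Big|_{t=\nu'(B_j)}\bigl(\mathbf\Gamma(-l+t)\,z^{-l+t}\bigr)\quad(0\le r<m_{B_j}).$$ Let $D_{A,m_A}$ be the $n\times n$ matrix with rows and columns indexed by the pairs $(j,r)$, $0\le r<m_{A_j}$, whose entry at $(j,r),(j',r')$ is $\binom r{r'}A_j$ if $j=j'$ and $r'\le r$, and $0$ otherwise; $D_{B,m_B}$ is defined in the same way. A formal logarithmic series at $0$ (at $\infty$) is a formal sum $\sum_a z^a p_a(\log z)$, with $p_a\in\mathbb C[X]$ of bounded degree, in which $p_a\neq0$ only for $a$ in finitely many progressions $c+\mathbb Z_{\ge0}$ (respectively $c-\mathbb Z_{\ge 0}$), $c\in\mathbb C$. The local monodromy at $0$ is one positive turn around $0$, i.e. $\log z\mapsto\log z+2\pi i$; the local monodromy at $\infty$ is one positive turn around $\infty$, i.e. $\log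 z\mapsto\log z-2\pi i$. The matrix of a linear map has as its columns the coordinates of the images of the basis vectors. Then: 1. The formal series $S_{A_j,r}$ form a basis of the space of formal logarithmic series at $0$ that solve $\mathcal H$, and in this basis the local monodromy at $0$ is given by the matrix $D_{A,m_A}^{\,t}$. Moreover the series $S_{A_j,r}$ converge on the universal cover of $\{0<|z|<1\}$, and for every $0<\rho\le1$ their sums form a basis of the space of holomorphic solutions of $\mathcal H$ on the universal cover of $\{0<|z|<\rho\}$; in this basis the local monodromy at $0$ is given by $D_{A,m_A}^{\,t}$. 2. The formal series $S_{B_j,r}$ form a basis of the space of formal logarithmic series at $\infty$ that solve $\mathcal H$, and in this basis the local monodromy at $\infty$ is given by the matrix $(D_{B,m_B}^{\,t})^{-1}$. Moreover the series $S_{B_j,r}$ converge on the universal cover of $\{1<|z|<\infty\}$, and for every $R\ge1$ their sums form a basis of the space of holomorphic solutions of $\mathcal H$ on the universal cover of $\{R<|z|<\infty\}$; in this basis the local monodromy at $\infty$ is given by $(D_{B,m_B}^{\,t})^{-1}$. -/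

import Mathlib

open Polynomial TopologicalSpace

noncomputable section

namespace Hypergeom

/-! ### The balanced gamma product -/

/-- `𝚪(s) = 1 / (∏ Γ(s - α_i + 1) ∏ Γ(-s + β_i + 1))`. Mathlib's `Complex.Gamma` takes the value `0`
at its poles and `0⁻¹ = 0`, so that this is the usual entire function. -/
def gammaProd {n : ℕ} (α β : Fin n → ℂ) (s : ℂ) : ℂ :=
  ((∏ i, Complex.Gamma (s - α i + 1)) * ∏ i, Complex.Gamma (-s + β i + 1))⁻¹

/-- The number `2πi`. -/
def twoPiI : ℂ := 2 * (Real.pi : ℂ) * Complex.I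

/-! ### Exponents and indices -/

/-- The finite set of distinct values among `exp(2πi x_1), …, exp(2πi x_n)`. -/
def expValues {n : ℕ} (x : Fin n → ℂ) : Finset ℂ :=
  Finset.univ.image fun k => Complex.exp (twoPiI * x k)

/-- The multiplicity `m_A = #{k : exp(2πi x_k) = A}`. -/
def mult {n : ℕ} (x : Fin n → ℂ) (A : expValues x) : ℕ :=
  (Finset.univ.filter fun k => Complex.exp (twoPiI * x k) = A).card

/-- Pairs `(A, r)` with `A` one of the distinct values and `0 ≤ r < m_A`. -/
abbrev LocalIndex {n : ℕ} (x : Fin n → ℂ) : Type :=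
  Σ A : expValues x, Fin (mult x A)

theorem exists_min_re {n : ℕ} (x : Fin n → ℂ) (A : expValues x) :
    ∃ k, Complex.exp (twoPiI * x k) = A ∧
      ∀ k', Complex.exp (twoPiI * x k') = A → (x k).re ≤ (x k').re := by
  obtain ⟨k₀, -, hk₀⟩ := Finset.mem_image.1 A.2
  obtain ⟨k, hk, hmin⟩ := Finset.exists_min_image
    (Finset.univ.filter fun k => Complex.exp (twoPiI * x k) = A) (fun k => (x k).re)
    ⟨k₀, by simpa using hk₀⟩
  exact ⟨k, by simpa using hk, fun k' hk' => hmin k' (by simpa using hk')⟩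

theorem exists_max_re {n : ℕ} (x : Fin n → ℂ) (A : expValues x) :
    ∃ k, Complex.exp (twoPiI * x k) = A ∧
      ∀ k', Complex.exp (twoPiI * x k') = A → (x k').re ≤ (x k).re := by
  obtain ⟨k₀, -, hk₀⟩ := Finset.mem_image.1 A.2
  obtain ⟨k, hk, hmax⟩ := Finset.exists_max_image
    (Finset.univ.filter fun k => Complex.exp (twoPiI * x k) = A) (fun k => (x k).re)
    ⟨k₀, by simpa using hk₀⟩
  exact ⟨k, by simpa using hk, fun k' hk' => hmax k' (by simpa using hk')⟩

/-- The entry of `x` with `exp(2πi x_k) = A` of minimal real part (entries with the same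
exponential differ by integers, so its value is unique). -/
def nuMin {n : ℕ} (x : Fin n → ℂ) (A : expValues x) : ℂ :=
  x (exists_min_re x A).choose

/-- The entry of `x` with `exp(2πi x_k) = A` of maximal real part. -/
def nuMax {n : ℕ} (x : Fin n → ℂ) (A : expValues x) : ℂ :=
  x (exists_max_re x A).choose

/-- The block-diagonal matrix `D_{A,m}`, with entries `binom(r, r') A_j` for `j = j'`, `r' ≤ r`, and
`0` otherwise, where `A` runs over the distinct values `exp(2πi x_k)`. -/
def blockD {n : ℕ} (x : Fin n → ℂ) : Matrix (LocalIndex x) (LocalIndex x) ℂ :=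
  fun p q =>
    if p.1 = q.1 ∧ (q.2 : ℕ) ≤ (p.2 : ℕ) then ((p.2 : ℕ).choose (q.2 : ℕ) : ℂ) * (p.1 : ℂ) else 0

/-! ### The hypergeometric operator -/

section Operator

variable {M : Type*} [AddCommGroup M] [Module ℂ M]

/-- `(-1)^n ∏ (D - α_i) - z ∏ (D - β_j)`, acting on a space on which `D = z d/dz` and multiplication
by `z` act as linear endomorphisms `D` and `Z`. -/
def hypOp (D Z : Module.End ℂ M) {n : ℕ} (α β : Fin n → ℂ) : Module.End ℂ M :=
  ((-1 : ℂ) ^ n) • aeval D (∏ i, (X - C (α i))) - Z * aeval D (∏ j, (X - C (β j)))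

theorem hypOp_commute {D Z T : Module.End ℂ M} (hD : Commute T D) (hZ : Commute T Z)
    {n : ℕ} (α β : Fin n → ℂ) : Commute T (hypOp D Z α β) := by
  have key : ∀ p : ℂ[X], Commute T (aeval D p) := fun p => by
    induction p using Polynomial.induction_on' with
    | add p q hp hq => rw [map_add]; exact hp.add_right hq
    | monomial k c =>
      rw [aeval_monomial]
      have hc : Commute T (algebraMap ℂ (Module.End ℂ M) c) := (Algebra.commutes c T).symm
      exact hc.mul_right (hD.pow_right k)
  exact ((key _).smul_right _).sub_right (hZ.mul_right (key _))

theorem mem_ker_of_commute {T H : Module.End ℂ M} (h : Commute T H) :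
    ∀ x ∈ LinearMap.ker H, T x ∈ LinearMap.ker H := fun x hx => by
  have h' : T (H x) = H (T x) := LinearMap.congr_fun h.eq x
  rw [LinearMap.mem_ker] at hx ⊢
  rw [← h', hx, map_zero]

end Operator

/-! ### Formal logarithmic series

A formal series `∑ z^a p_a(log z)` is the family `a ↦ p_a` of polynomials (the variable `X` stands
for `log z`). The parameter `σ` is `1` for series at `0` and `-1` for series at `∞`. -/

/-- Formal logarithmic series at `0` (`σ = 1`), respectively at `∞` (`σ = -1`): the exponents lie in
finitely many progressions `c, c + σ, c + 2σ, …` and the degree in `log z` is bounded. -/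
def FormalLog (σ : ℤ) : Submodule ℂ (ℂ → ℂ[X]) where
  carrier := {f | ∃ (T : Finset ℂ) (N : ℕ), ∀ a, f a ≠ 0 →
    (∃ c ∈ T, ∃ l : ℕ, a = c + (σ : ℂ) * l) ∧ (f a).natDegree ≤ N}
  zero_mem' := ⟨∅, 0, fun a h => absurd rfl h⟩
  add_mem' := by
    rintro f g ⟨T, N, hf⟩ ⟨T', N', hg⟩
    refine ⟨T ∪ T', max N N', fun a h => ⟨?_, ?_⟩⟩
    · by_cases h0 : f a = 0
      · have h1 : g a ≠ 0 := fun h1 => h (by simp [h0, h1])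
        obtain ⟨c, hc, l, hl⟩ := (hg a h1).1
        exact ⟨c, Finset.mem_union_right _ hc, l, hl⟩
      · obtain ⟨c, hc, l, hl⟩ := (hf a h0).1
        exact ⟨c, Finset.mem_union_left _ hc, l, hl⟩
    · refine (natDegree_add_le _ _).trans (max_le_max ?_ ?_)
      · by_cases h0 : f a = 0
        · simp [h0]
        · exact (hf a h0).2
      · by_cases h0 : g a = 0
        · simp [h0]
        · exact (hg a h0).2
  smul_mem' := by
    rintro c f ⟨T, N, hf⟩
    refine ⟨T, N, fun a h => ?_⟩
    have h0 : f a ≠ 0 := fun h0 => h (by simp [h0])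
    exact ⟨(hf a h0).1, (natDegree_smul_le _ _).trans (hf a h0).2⟩

/-- `D = z d/dz`: it sends `z^a p(log z)` to `z^a (a p + p')(log z)`. -/
def formalD (σ : ℤ) : Module.End ℂ (FormalLog σ) where
  toFun f := ⟨fun a => a • f.1 a + derivative (f.1 a), by
    obtain ⟨T, N, hf⟩ := f.2
    refine ⟨T, N, fun a h => ?_⟩
    have h0 : f.1 a ≠ 0 := fun h0 => h (by simp [h0])
    refine ⟨(hf a h0).1, (natDegree_add_le _ _).trans (max_le ?_ ?_)⟩
    · exact (natDegree_smul_le _ _).trans (hf a h0).2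
    · exact (natDegree_derivative_le _).trans ((Nat.sub_le _ _).trans (hf a h0).2)⟩
  map_add' f g := by
    ext1; funext a
    simp only [Submodule.coe_add, Pi.add_apply, smul_add, map_add]
    abel
  map_smul' c f := by
    ext1; funext a
    simp only [Submodule.coe_smul, Pi.smul_apply, derivative_smul, RingHom.id_apply, smul_add]
    rw [smul_comm]

/-- Multiplication by `z`. -/
def formalZ (σ : ℤ) : Module.End ℂ (FormalLog σ) where
  toFun f := ⟨fun a => f.1 (a - 1), by
    obtain ⟨T, N, hf⟩ := f.2
    refine ⟨T.image (· + 1), N, fun a h => ⟨?_, (hf _ h).2⟩⟩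
    obtain ⟨c, hc, l, hl⟩ := (hf _ h).1
    exact ⟨c + 1, Finset.mem_image_of_mem _ hc, l, by linear_combination hl⟩⟩
  map_add' f g := rfl
  map_smul' c f := rfl

/-- `k`-fold continuation around `0` in the positive direction: `log z ↦ log z + 2πik`, and
`z^a ↦ exp(2πika) z^a`. -/
def formalDeck (σ k : ℤ) : Module.End ℂ (FormalLog σ) where
  toFun f := ⟨fun a => Complex.exp (twoPiI * k * a) • (f.1 a).comp (X + C (twoPiI * k)), by
    obtain ⟨T, N, hf⟩ := f.2
    refine ⟨T, N, fun a h => ?_⟩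
    have h0 : f.1 a ≠ 0 := fun h0 => h (by simp [h0])
    refine ⟨(hf a h0).1, (natDegree_smul_le _ _).trans ?_⟩
    rw [natDegree_comp, natDegree_X_add_C, mul_one]
    exact (hf a h0).2⟩
  map_add' f g := by
    ext1; funext a
    simp only [Submodule.coe_add, Pi.add_apply, smul_add, add_comp]
  map_smul' c f := by
    ext1; funext a
    simp only [Submodule.coe_smul, Pi.smul_apply, RingHom.id_apply, smul_comp]
    rw [smul_comm]

theorem formalDeck_commute_D (σ k : ℤ) : Commute (formalDeck σ k) (formalD σ) := by
  refine LinearMap.ext fun f => Subtype.ext (funext fun a => ?_)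
  simp [formalDeck, formalD, derivative_comp, smul_comp, smul_add, smul_comm a]

theorem formalDeck_commute_Z (σ k : ℤ) : Commute (formalDeck σ k) (formalZ σ) := by
  refine LinearMap.ext fun f => Subtype.ext (funext fun a => ?_)
  have h : Complex.exp (twoPiI * k * a) = Complex.exp (twoPiI * k * (a - 1)) := by
    rw [Complex.exp_eq_exp_iff_exists_int]
    exact ⟨k, by simp only [twoPiI]; ring⟩
  simp [formalDeck, formalZ, h]

/-- The formal solutions at `0` (`σ = 1`), respectively at `∞` (`σ = -1`). -/
def formalSolutions (σ : ℤ) {n : ℕ} (α β : Fin n → ℂ) : Submodule ℂ (FormalLog σ) :=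
  LinearMap.ker (hypOp (formalD σ) (formalZ σ) α β)

/-- The local monodromy on formal solutions: one positive turn around the point. A positive turn
around `∞` (`σ = -1`) is a negative turn around `0`. -/
def formalMonodromy (σ : ℤ) {n : ℕ} (α β : Fin n → ℂ) :
    Module.End ℂ (formalSolutions σ α β) :=
  (formalDeck σ σ).restrict (mem_ker_of_commute
    (hypOp_commute (formalDeck_commute_D σ σ) (formalDeck_commute_Z σ σ) α β))

/-- `(∂ / (2πi ∂s))^r (𝚪(s) z^s) = z^s · logCoeff α β r s (log z)`, expanded by the Leibniz rule. -/
def logCoeff {n : ℕ} (α β : Fin n → ℂ) (r : ℕ) (s : ℂ) : ℂ[X] :=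
  ∑ p ∈ Finset.range (r + 1),
    C ((twoPiI⁻¹) ^ r * (r.choose p : ℂ) * iteratedDeriv (r - p) (gammaProd α β) s) * X ^ p

open Classical in
/-- The formal series `∑_{l ≥ 0} (∂ / (2πi ∂t))^r |_{t = ν} (𝚪(σl + t) z^{σl + t})`. -/
def formalSeries (σ : ℤ) {n : ℕ} (α β : Fin n → ℂ) (ν : ℂ) (r : ℕ) : FormalLog σ :=
  ⟨fun a => if ∃ l : ℕ, a = ν + (σ : ℂ) * l then logCoeff α β r a else 0, by
    refine ⟨{ν}, r, fun a h => ?_⟩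
    have ha : ∃ l : ℕ, a = ν + (σ : ℂ) * l := by
      by_contra hne
      exact h (if_neg hne)
    refine ⟨⟨ν, Finset.mem_singleton_self ν, ha⟩, ?_⟩
    beta_reduce
    rw [if_pos ha]
    refine natDegree_sum_le_of_forall_le _ _ fun p hp => ?_
    exact (natDegree_C_mul_X_pow_le _ _).trans (Nat.lt_succ_iff.1 (Finset.mem_range.1 hp))⟩

/-! ### Holomorphic functions on logarithmic covers

For an open `V ⊆ ℂ`, a multivalued function on `V \ {0}` is a function of `u = log z` on
`{u | exp u ∈ V}`; there `D = z d/dz` is `d/du`. -/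

/-- The cover `{u | exp u ∈ V}` of `V \ {0}`. It is the universal cover if `V` is a punctured disc
at `0` or at `∞`. -/
def logCover (V : Opens ℂ) : Opens ℂ :=
  ⟨Complex.exp ⁻¹' V, V.2.preimage Complex.continuous_exp⟩

theorem logCover_add (V : Opens ℂ) (k : ℤ) (u : ℂ) :
    u + twoPiI * k ∈ logCover V ↔ u ∈ logCover V := by
  have h : Complex.exp (u + twoPiI * k) = Complex.exp u := by
    rw [Complex.exp_eq_exp_iff_exists_int]
    exact ⟨k, by simp only [twoPiI]; ring⟩
  change Complex.exp (u + twoPiI * k) ∈ V ↔ Complex.exp u ∈ V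
  rw [h]

/-- The space of holomorphic functions on `logCover V`; a function on `logCover V` is represented by
its extension by zero to `ℂ`. -/
def Hol (V : Opens ℂ) : Submodule ℂ (ℂ → ℂ) where
  carrier := {f | DifferentiableOn ℂ f (logCover V) ∧ ∀ u, u ∉ logCover V → f u = 0}
  zero_mem' := ⟨differentiableOn_const 0, fun _ _ => rfl⟩
  add_mem' := fun hf hg => ⟨hf.1.add hg.1, fun u hu => by
    rw [Pi.add_apply, hf.2 u hu, hg.2 u hu, add_zero]⟩
  smul_mem' := fun c f hf => ⟨hf.1.const_smul c, fun u hu => by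
    rw [Pi.smul_apply, hf.2 u hu, smul_zero]⟩

theorem Hol.differentiableAt {V : Opens ℂ} (f : Hol V) {u : ℂ} (hu : u ∈ logCover V) :
    DifferentiableAt ℂ f.1 u :=
  f.2.1.differentiableAt ((logCover V).2.mem_nhds hu)

open Classical in
/-- `D = z d/dz = d/du`. -/
def holD (V : Opens ℂ) : Module.End ℂ (Hol V) where
  toFun f := ⟨fun u => if u ∈ logCover V then deriv f.1 u else 0,
    (f.2.1.deriv (logCover V).2).congr fun _ hu => if_pos hu, fun _ hu => if_neg hu⟩
  map_add' f g := by
    ext1; funext u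
    by_cases hu : u ∈ logCover V
    · simp [hu, deriv_add (Hol.differentiableAt f hu) (Hol.differentiableAt g hu)]
    · simp [hu]
  map_smul' c f := by
    ext1; funext u
    by_cases hu : u ∈ logCover V
    · simp [hu, deriv_const_smul c (Hol.differentiableAt f hu)]
    · simp [hu]

/-- Multiplication by `z = exp u`. -/
def holZ (V : Opens ℂ) : Module.End ℂ (Hol V) where
  toFun f := ⟨fun u => Complex.exp u * f.1 u,
    Complex.differentiable_exp.differentiableOn.mul f.2.1,
    fun u hu => by beta_reduce; rw [f.2.2 u hu, mul_zero]⟩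
  map_add' f g := by ext1; funext u; simp [mul_add]
  map_smul' c f := by ext1; funext u; simp [mul_left_comm]

/-- `k`-fold analytic continuation around `0` in the positive direction, `u ↦ u + 2πik`. -/
def holDeck (V : Opens ℂ) (k : ℤ) : Module.End ℂ (Hol V) where
  toFun f := ⟨fun u => f.1 (u + twoPiI * k),
    f.2.1.comp (differentiableOn_id.add_const _) fun u hu => (logCover_add V k u).2 hu,
    fun u hu => f.2.2 _ fun h => hu ((logCover_add V k u).1 h)⟩
  map_add' _ _ := rfl
  map_smul' _ _ := rfl

theorem holDeck_commute_D (V : Opens ℂ) (k : ℤ) : Commute (holDeck V k) (holD V) := by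
  refine LinearMap.ext fun f => Subtype.ext (funext fun u => ?_)
  by_cases hu : u ∈ logCover V
  · simp [holDeck, holD, hu, logCover_add, deriv_comp_add_const]
  · simp [holDeck, holD, hu, logCover_add]

theorem holDeck_commute_Z (V : Opens ℂ) (k : ℤ) : Commute (holDeck V k) (holZ V) := by
  refine LinearMap.ext fun f => Subtype.ext (funext fun u => ?_)
  have h : Complex.exp (u + twoPiI * k) = Complex.exp u := by
    rw [Complex.exp_eq_exp_iff_exists_int]
    exact ⟨k, by simp only [twoPiI]; ring⟩
  simp [holDeck, holZ, h]

/-- The holomorphic solutions on `logCover V`. -/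
def holSolutions (V : Opens ℂ) {n : ℕ} (α β : Fin n → ℂ) : Submodule ℂ (Hol V) :=
  LinearMap.ker (hypOp (holD V) (holZ V) α β)

/-- Analytic continuation of solutions along `k` positive turns around `0`. -/
def holMonodromy (V : Opens ℂ) (k : ℤ) {n : ℕ} (α β : Fin n → ℂ) :
    Module.End ℂ (holSolutions V α β) :=
  (holDeck V k).restrict (mem_ker_of_commute
    (hypOp_commute (holDeck_commute_D V k) (holDeck_commute_Z V k) α β))

/-- The punctured disc `0 < |z| < ρ`. -/
def discZero (ρ : ℝ) : Opens ℂ :=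
  ⟨{z | 0 < ‖z‖ ∧ ‖z‖ < ρ},
    (isOpen_lt continuous_const continuous_norm).inter (isOpen_lt continuous_norm continuous_const)⟩

/-- The punctured disc `R < |z| < ∞` around `∞`. -/
def discInfty (R : ℝ) : Opens ℂ :=
  ⟨{z | R < ‖z‖}, isOpen_lt continuous_const continuous_norm⟩

/-- The value at `z = exp u` of the `l`-th term
`(∂ / (2πi ∂t))^r |_{t = ν} (𝚪(σl + t) z^{σl + t})`, where `z^s = exp (s u)`. -/
def seriesTerm (σ : ℤ) {n : ℕ} (α β : Fin n → ℂ) (ν : ℂ) (r : ℕ) (u : ℂ) (l : ℕ) : ℂ :=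
  (twoPiI⁻¹) ^ r * iteratedDeriv r
    (fun t : ℂ => gammaProd α β ((σ : ℂ) * l + t) * Complex.exp (((σ : ℂ) * l + t) * u)) ν

theorem gammaProd_differentiable {n : ℕ} (α β : Fin n → ℂ) : Differentiable ℂ (gammaProd α β) := by
  have h : gammaProd α β = fun s => (∏ i, (Complex.Gamma (s - α i + 1))⁻¹) *
      ∏ i, (Complex.Gamma (-s + β i + 1))⁻¹ := by
    funext s
    simp [gammaProd, mul_comm]
  rw [h]
  refine Differentiable.mul ?_ ?_
  · refine Differentiable.fun_finsetProd fun i _ => ?_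
    exact Complex.differentiable_one_div_Gamma.comp (by fun_prop : Differentiable ℂ fun s => s - α i + 1)
  · refine Differentiable.fun_finsetProd fun i _ => ?_
    exact Complex.differentiable_one_div_Gamma.comp (by fun_prop : Differentiable ℂ fun s => -s + β i + 1)

/-- The coefficients of the formal series are those obtained by differentiating in `t`. -/
theorem seriesTerm_eq (σ : ℤ) {n : ℕ} (α β : Fin n → ℂ) (ν : ℂ) (r : ℕ) (u : ℂ) (l : ℕ) :
    seriesTerm σ α β ν r u l =
      Complex.exp ((ν + (σ : ℂ) * l) * u) * (logCoeff α β r (ν + (σ : ℂ) * l)).eval u := by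
  have h1 := congrFun (iteratedDeriv_comp_const_add r
    (fun s : ℂ => gammaProd α β s * Complex.exp (s * u)) ((σ : ℂ) * l)) ν
  have h2 : ∀ s : ℂ, ∀ p, iteratedDeriv p (fun s : ℂ => Complex.exp (s * u)) s
      = u ^ p * Complex.exp (s * u) := by
    intro s p
    simp [mul_comm _ u]
  have h3 := iteratedDeriv_fun_mul (n := r) (x := (σ : ℂ) * l + ν) (f := gammaProd α β)
    (g := fun s : ℂ => Complex.exp (s * u)) (gammaProd_differentiable α β).contDiff.contDiffAt
    (by fun_prop)
  simp only [seriesTerm, h1, h3, h2, logCoeff, eval_finsetSum, Finset.mul_sum]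
  rw [← Finset.sum_range_reflect]
  refine Finset.sum_congr rfl fun p hp => ?_
  have hp' : p ≤ r := Nat.lt_succ_iff.1 (Finset.mem_range.1 hp)
  have e : r + 1 - 1 - p = r - p := by omega
  have e' : r - (r - p) = p := by omega
  simp only [e, e', Nat.choose_symm hp', eval_mul, eval_C, eval_pow, eval_X,
    add_comm ((σ : ℂ) * l) ν]
  ring

end Hypergeom

end

open Polynomial TopologicalSpace

noncomputable section

namespace Hypergeom

section

/-! ### The functional equation of the gamma product -/

/-! The recursion of Γ, in reciprocal form, gives (-1)^n ∏(t - α_i) 𝚪(t) = ∏(t - 1 - β_j) 𝚪(t - 1)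
for every t (`gammaProd_functional`). Hence the bilateral series ∑_{l ∈ ℤ} 𝚪(l + t) z^(l + t) solves
the equation formally for every t, and so do its t-derivatives. At t = ν(A) the m_A factors 1/Γ(s -
α_i + 1) of the class A all vanish at ν(A) - 1, ν(A) - 2, …, so for r < m_A the r-th derivative has
no left half and is exactly S_{A,r}. At ∞ the same happens with the direction reversed and β in
place of α; `IsLocalExponent` records what the two ends share, σ = ±1 being the direction.

Continuation multiplies z^s by exp(2πis), and Leibniz' rule turns this into the matrix `blockD`. Its
transpose has only the coordinate vectors at (A, 0) as eigenvectors, up to scalars, so a nontrivial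
linear relation would force some S_{A,0} = 0 (`linearIndependent_of_blockD`). As the m_A add up to
n, it remains to bound the dimension of each solution space by n.

For formal series, D - α_i acts on the coefficient of z^a as a - α_i + d/dX, which is injective and
preserves degrees unless a = α_i, when it lowers the degree by one. In a class A this leaves m_A
free constants, and since no β_j lies in that class they determine the solution
(`finrank_le_of_recurrence`). For holomorphic solutions the leading coefficient (-1)^n - z is
nonzero off |z| = 1, so the first n derivatives at one point determine all of them
(`finrank_holSolutions`).

Convergence follows from the ratio test applied to the functional equation, with Cauchy's estimate
for the t-derivatives. The convergence is locally normal, so D, z and continuation act term by term,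
and the formal identities pass to the sums (`LogExpands`). -/

theorem gammaProd_eq_prod_inv {n : ℕ} (α β : Fin n → ℂ) (s : ℂ) :
    gammaProd α β s = (∏ i, (Complex.Gamma (s - α i + 1))⁻¹) *
      ∏ i, (Complex.Gamma (-s + β i + 1))⁻¹ := by
  simp [gammaProd, mul_comm]

/-- One application of 1/Γ(s) = s/Γ(s + 1) to each of the 2n factors. This form of the recursion
holds at the poles of Γ too, so no t is excluded. -/
theorem gammaProd_functional {n : ℕ} (α β : Fin n → ℂ) (t : ℂ) :
    (-1) ^ n * (∏ i, (t - α i)) * gammaProd α β t =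
      (∏ j, (t - 1 - β j)) * gammaProd α β (t - 1) := by
  have h1 : ∀ i, (Complex.Gamma (t - 1 - α i + 1))⁻¹ =
      (t - α i) * (Complex.Gamma (t - α i + 1))⁻¹ := fun i => by
    rw [← Complex.one_div_Gamma_eq_self_mul_one_div_Gamma_add_one]
    congr 2; ring
  have h2 : ∀ i, (Complex.Gamma (-t + β i + 1))⁻¹ =
      (-t + β i + 1) * (Complex.Gamma (-(t - 1) + β i + 1))⁻¹ := fun i => by
    rw [Complex.one_div_Gamma_eq_self_mul_one_div_Gamma_add_one]
    congr 3; ring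
  have h3 : ∏ j, (t - 1 - β j) = (-1) ^ n * ∏ j, (-t + β j + 1) := by
    have : ∀ j, t - 1 - β j = (-1) * (-t + β j + 1) := fun j => by ring
    simp_rw [this, Finset.prod_mul_distrib]
    simp
  rw [gammaProd_eq_prod_inv, gammaProd_eq_prod_inv, h3]
  simp_rw [h1, h2, Finset.prod_mul_distrib]
  ring

theorem twoPiI_ne_zero : twoPiI ≠ 0 := by
  simp [twoPiI, Complex.I_ne_zero, Real.pi_ne_zero]

theorem exp_twoPiI_eq_iff {x y : ℂ} :
    Complex.exp (twoPiI * x) = Complex.exp (twoPiI * y) ↔ ∃ k : ℤ, x = y + k := by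
  rw [Complex.exp_eq_exp_iff_exists_int]
  refine exists_congr fun k => ⟨fun h => ?_, fun h => by rw [h]; simp only [twoPiI]; ring⟩
  refine mul_left_cancel₀ twoPiI_ne_zero ?_
  rw [h]; simp only [twoPiI]; ring

theorem exp_twoPiI_int_mul_add (k : ℤ) (a : ℂ) :
    Complex.exp (twoPiI * (a + k)) = Complex.exp (twoPiI * a) :=
  exp_twoPiI_eq_iff.2 ⟨k, rfl⟩

/-! ### Solutions of the formal equation, coefficientwise -/

/-- The operator `a + d/dX`, through which `D` acts on the coefficient of `z^a`. -/
def shiftedDeriv (a : ℂ) : Module.End ℂ ℂ[X] := algebraMap ℂ (Module.End ℂ ℂ[X]) a + derivative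

theorem shiftedDeriv_apply (a : ℂ) (p : ℂ[X]) : shiftedDeriv a p = a • p + derivative p := rfl

/-- Used for the extraction of a coefficient, which carries D on series to `shiftedDeriv a` on
polynomials. -/
theorem aeval_intertwine {M N : Type*} [AddCommGroup M] [Module ℂ M] [AddCommGroup N] [Module ℂ N]
    (φ : M →ₗ[ℂ] N) {D : Module.End ℂ M} {E : Module.End ℂ N} (h : ∀ x, φ (D x) = E (φ x))
    (p : ℂ[X]) (x : M) : φ (aeval D p x) = aeval E p (φ x) := by
  induction p using Polynomial.induction_on generalizing x with
  | C c => simp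
  | add p q hp hq => simp [hp, hq]
  | monomial k c ih =>
    rw [pow_succ, ← mul_assoc, map_mul (aeval D), map_mul (aeval E), aeval_X, aeval_X,
      Module.End.mul_apply, Module.End.mul_apply, ih, h]

/-- The coefficient of `z^a`. -/
def logCoeffAt (σ : ℤ) (a : ℂ) : FormalLog σ →ₗ[ℂ] ℂ[X] :=
  LinearMap.proj a ∘ₗ (FormalLog σ).subtype

theorem aeval_formalD_apply (σ : ℤ) (p : ℂ[X]) (f : FormalLog σ) (a : ℂ) :
    (aeval (formalD σ) p f).1 a = aeval (shiftedDeriv a) p (f.1 a) :=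
  aeval_intertwine (logCoeffAt σ a) (E := shiftedDeriv a) (fun _ => rfl) p f

theorem mem_formalSolutions_iff {σ : ℤ} {n : ℕ} {α β : Fin n → ℂ} {f : FormalLog σ} :
    f ∈ formalSolutions σ α β ↔ ∀ a,
      (-1 : ℂ) ^ n • aeval (shiftedDeriv a) (∏ i, (X - C (α i))) (f.1 a) =
        aeval (shiftedDeriv (a - 1)) (∏ j, (X - C (β j))) (f.1 (a - 1)) := by
  rw [formalSolutions, LinearMap.mem_ker, ← Subtype.coe_inj, funext_iff]
  refine forall_congr' fun a => ?_
  rw [← aeval_formalD_apply, ← aeval_formalD_apply]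
  exact sub_eq_zero

/-! ### Leibniz polynomials -/

/-- The polynomial `L` with `(∂ / (2πi ∂s))^r (g(s) z^s) = z^s L(log z)`. -/
def leibnizPoly (g : ℂ → ℂ) (r : ℕ) (s : ℂ) : ℂ[X] :=
  ∑ p ∈ Finset.range (r + 1),
    C ((twoPiI⁻¹) ^ r * (r.choose p : ℂ) * iteratedDeriv (r - p) g s) * X ^ p

theorem logCoeff_eq_leibnizPoly {n : ℕ} (α β : Fin n → ℂ) (r : ℕ) (s : ℂ) :
    logCoeff α β r s = leibnizPoly (gammaProd α β) r s := rfl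

theorem leibnizPoly_coeff (g : ℂ → ℂ) (r : ℕ) (s : ℂ) (p : ℕ) :
    (leibnizPoly g r s).coeff p =
      (twoPiI⁻¹) ^ r * (r.choose p : ℂ) * iteratedDeriv (r - p) g s := by
  simp only [leibnizPoly, finsetSum_coeff, coeff_C_mul, coeff_X_pow, mul_ite, mul_one, mul_zero]
  rw [Finset.sum_ite_eq]
  split_ifs with h
  · rfl
  · rw [Nat.choose_eq_zero_of_lt (by simpa using h)]; simp

theorem leibnizPoly_eval {g : ℂ → ℂ} (hg : Differentiable ℂ g) (r : ℕ) (s u : ℂ) :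
    Complex.exp (s * u) * (leibnizPoly g r s).eval u =
      (twoPiI⁻¹) ^ r * iteratedDeriv r (fun t => g t * Complex.exp (t * u)) s := by
  have h2 : ∀ p, iteratedDeriv p (fun s : ℂ => Complex.exp (s * u)) s
      = u ^ p * Complex.exp (s * u) := by
    intro p
    simp [mul_comm _ u]
  rw [iteratedDeriv_fun_mul hg.contDiff.contDiffAt (by fun_prop)]
  simp only [h2, leibnizPoly, eval_finsetSum, Finset.mul_sum]
  rw [← Finset.sum_range_reflect]
  refine Finset.sum_congr rfl fun p hp => ?_
  have hp' : p ≤ r := Nat.lt_succ_iff.1 (Finset.mem_range.1 hp)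
  have e : r + 1 - 1 - p = r - p := by omega
  have e' : r - (r - p) = p := by omega
  simp only [e, e', Nat.choose_symm hp', eval_mul, eval_C, eval_pow, eval_X]
  ring

/-- Leibniz' rule stops after two terms because t'' = 0. For k = 0 the truncated index k - 1 is
harmless, its factor being zero. -/
theorem iteratedDeriv_id_mul {g : ℂ → ℂ} (hg : Differentiable ℂ g) (k : ℕ) (t : ℂ) :
    iteratedDeriv k (fun t => t * g t) t =
      t * iteratedDeriv k g t + k * iteratedDeriv (k - 1) g t := by
  have hd : ∀ m, Differentiable ℂ (iteratedDeriv m g) := fun m =>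
    hg.contDiff.differentiable_iteratedDeriv (n := ⊤) m (WithTop.coe_lt_top _)
  induction k generalizing t with
  | zero => simp
  | succ k ih =>
    have ih' : iteratedDeriv k (fun t => t * g t) =
        fun t => t * iteratedDeriv k g t + k * iteratedDeriv (k - 1) g t := funext ih
    rw [iteratedDeriv_succ, ih', deriv_fun_add
      (differentiableAt_fun_id.fun_mul (hd k t)) ((hd _ t).const_mul _),
      deriv_fun_mul differentiableAt_fun_id (hd k t), deriv_const_mul _ (hd _ t)]
    rcases k with _ | k
    · simp [iteratedDeriv_succ, add_comm]
    · simp only [Nat.add_sub_cancel, ← iteratedDeriv_succ]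
      simp
      ring

/-- D commutes with ∂/∂s and D z^s = s z^s, so D acts on ∂^r(g(s) z^s) by replacing g(s) with s
g(s). On coefficients this is (p + 1) binom(r, p + 1) = (r - p) binom(r, p). -/
theorem shiftedDeriv_leibnizPoly {g : ℂ → ℂ} (hg : Differentiable ℂ g) (r : ℕ) (a : ℂ) :
    shiftedDeriv a (leibnizPoly g r a) = leibnizPoly (fun t => t * g t) r a := by
  ext p
  rw [shiftedDeriv_apply, coeff_add, coeff_smul, coeff_derivative, leibnizPoly_coeff,
    leibnizPoly_coeff, leibnizPoly_coeff, iteratedDeriv_id_mul hg, smul_eq_mul]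
  rcases lt_or_ge r p with h | h
  · rw [Nat.choose_eq_zero_of_lt h, Nat.choose_eq_zero_of_lt (h.trans (Nat.lt_succ_self p))]
    simp
  · have h1 : ((r.choose (p + 1) : ℕ) : ℂ) * (p + 1) = r.choose p * ((r - p : ℕ) : ℂ) := by
      exact_mod_cast Nat.choose_succ_right_eq r p
    rw [Nat.sub_add_eq]
    linear_combination (twoPiI⁻¹) ^ r * iteratedDeriv (r - p - 1) g a * h1

theorem leibnizPoly_smul (c : ℂ) (g : ℂ → ℂ) (r : ℕ) (a : ℂ) :
    leibnizPoly (fun t => c * g t) r a = c • leibnizPoly g r a := by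
  ext p
  rw [coeff_smul, leibnizPoly_coeff, leibnizPoly_coeff, iteratedDeriv_const_mul_field, smul_eq_mul]
  ring

theorem leibnizPoly_add {g h : ℂ → ℂ} (hg : Differentiable ℂ g) (hh : Differentiable ℂ h)
    (r : ℕ) (a : ℂ) :
    leibnizPoly (fun t => g t + h t) r a = leibnizPoly g r a + leibnizPoly h r a := by
  ext p
  rw [coeff_add, leibnizPoly_coeff, leibnizPoly_coeff, leibnizPoly_coeff,
    iteratedDeriv_fun_add hg.contDiff.contDiffAt hh.contDiff.contDiffAt]
  ring

theorem aeval_shiftedDeriv_leibnizPoly {g : ℂ → ℂ} (hg : Differentiable ℂ g) (r : ℕ) (a : ℂ)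
    (p : ℂ[X]) :
    aeval (shiftedDeriv a) p (leibnizPoly g r a) = leibnizPoly (fun t => p.eval t * g t) r a := by
  induction p using Polynomial.induction_on generalizing g with
  | C c => simp [leibnizPoly_smul]
  | add p q hp hq =>
    rw [map_add, LinearMap.add_apply, hp hg, hq hg,
      ← leibnizPoly_add (p.differentiable.fun_mul hg) (q.differentiable.fun_mul hg)]
    simp [add_mul]
  | monomial k c ih =>
    rw [pow_succ, ← mul_assoc, map_mul, aeval_X, Module.End.mul_apply,
      shiftedDeriv_leibnizPoly hg, ih (differentiable_fun_id.fun_mul hg)]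
    simp [mul_assoc]

theorem leibnizPoly_comp_sub (g : ℂ → ℂ) (r : ℕ) (a c : ℂ) :
    leibnizPoly (fun t => g (t - c)) r a = leibnizPoly g r (a - c) := by
  simp only [leibnizPoly, iteratedDeriv_comp_sub_const]

/-- The coefficients `logCoeff` satisfy the recurrence of the formal equation at every exponent. -/
theorem logCoeff_recurrence {n : ℕ} (α β : Fin n → ℂ) (r : ℕ) (a : ℂ) :
    (-1 : ℂ) ^ n • aeval (shiftedDeriv a) (∏ i, (X - C (α i))) (logCoeff α β r a) =
      aeval (shiftedDeriv (a - 1)) (∏ j, (X - C (β j))) (logCoeff α β r (a - 1)) := by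
  have hG := gammaProd_differentiable α β
  rw [logCoeff_eq_leibnizPoly, logCoeff_eq_leibnizPoly, aeval_shiftedDeriv_leibnizPoly hG,
    aeval_shiftedDeriv_leibnizPoly hG, ← leibnizPoly_smul, ← leibnizPoly_comp_sub]
  congr 1
  funext t
  have := gammaProd_functional α β t
  simp only [eval_prod, eval_sub, eval_X, eval_C]
  rw [← this]
  ring

/-- The effect of `log z ↦ log z + 2πi` on the Leibniz polynomials. -/
theorem leibnizPoly_comp_add {g : ℂ → ℂ} (hg : Differentiable ℂ g) (r : ℕ) (a : ℂ) :
    (leibnizPoly g r a).comp (X + C twoPiI) =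
      ∑ q ∈ Finset.range (r + 1), (r.choose q : ℂ) • leibnizPoly g q a := by
  refine Polynomial.funext fun u => ?_
  refine mul_left_cancel₀ (Complex.exp_ne_zero (a * (u + twoPiI))) ?_
  have h2 : ∀ p, iteratedDeriv p (fun s : ℂ => Complex.exp (s * twoPiI)) a
      = twoPiI ^ p * Complex.exp (a * twoPiI) := by
    intro p
    simp [mul_comm _ twoPiI]
  rw [eval_comp]
  simp only [eval_add, eval_X, eval_C]
  rw [leibnizPoly_eval hg]
  -- The turn multiplies z^t by exp(2πit). Each of the r - q derivatives that fall on this factor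
  -- yields 2πi, which cancels against the normalisation.
  have h3 : (fun t => g t * Complex.exp (t * (u + twoPiI))) =
      fun t => (g t * Complex.exp (t * u)) * Complex.exp (t * twoPiI) := by
    funext t
    rw [mul_add, Complex.exp_add, mul_assoc]
  rw [h3, iteratedDeriv_fun_mul (Differentiable.contDiff (by fun_prop)).contDiffAt (by fun_prop),
    eval_finsetSum, Finset.mul_sum, Finset.mul_sum]
  refine Finset.sum_congr rfl fun q hq => ?_
  have hq' : q ≤ r := Nat.lt_succ_iff.1 (Finset.mem_range.1 hq)
  have h4 := leibnizPoly_eval hg q a u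
  have h5 : (twoPiI⁻¹) ^ r = (twoPiI⁻¹) ^ q * (twoPiI⁻¹) ^ (r - q) := by
    rw [← pow_add]; congr 1; omega
  have h6 : (twoPiI⁻¹) ^ (r - q) * twoPiI ^ (r - q) = 1 := by
    rw [← mul_pow, inv_mul_cancel₀ twoPiI_ne_zero, one_pow]
  rw [h2, eval_smul, smul_eq_mul, mul_add, Complex.exp_add, h5]
  linear_combination (-(r.choose q : ℂ) * Complex.exp (a * twoPiI)) * h4 +
    (r.choose q : ℂ) * Complex.exp (a * twoPiI) * (twoPiI⁻¹) ^ q *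
      iteratedDeriv q (fun t => g t * Complex.exp (t * u)) a * h6

/-! ### Bases adapted to a monodromy operator -/

theorem blockD_diag {n : ℕ} (x : Fin n → ℂ) (A : expValues x) (r q : Fin (mult x A)) :
    blockD x ⟨A, r⟩ ⟨A, q⟩ = ((r : ℕ).choose (q : ℕ) : ℂ) * A := by
  unfold blockD
  split_ifs with h
  · rfl
  · rw [Nat.choose_eq_zero_of_lt (by simpa using h)]
    simp

theorem expValues_ne_zero {n : ℕ} (x : Fin n → ℂ) (A : expValues x) : (A : ℂ) ≠ 0 := by
  obtain ⟨k, -, hk⟩ := Finset.mem_image.1 A.2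
  rw [← hk]
  exact Complex.exp_ne_zero _

theorem sum_blockD_mul {n : ℕ} (x : Fin n → ℂ) (v : LocalIndex x → ℂ) (A : expValues x)
    (r : Fin (mult x A)) :
    ∑ q, blockD x q ⟨A, r⟩ * v q =
      ∑ q : Fin (mult x A), ((q : ℕ).choose (r : ℕ) : ℂ) * A * v ⟨A, q⟩ := by
  rw [Fintype.sum_sigma, Finset.sum_eq_single A]
  · simp_rw [blockD_diag]
  · intro B _ hB
    refine Finset.sum_eq_zero fun q _ => ?_
    rw [blockD, if_neg fun h => hB h.1, zero_mul]
  · simp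

/-- An eigenvector of the transpose of `blockD x` is supported on a single index `(A, 0)`. -/
theorem blockD_eigenvector {n : ℕ} {x : Fin n → ℂ} {v : LocalIndex x → ℂ} {c : ℂ}
    (hv : ∀ p, ∑ q, blockD x q p * v q = c * v p) {q : LocalIndex x} (hq : v q ≠ 0) :
    (q.1 : ℂ) = c ∧ (q.2 : ℕ) = 0 := by
  obtain ⟨A, r⟩ := q
  -- The topmost nonzero coordinate of the block: there the eigenvalue equation reduces to A v_s = c
  -- v_s.
  obtain ⟨s, hs, hmax⟩ := Finset.exists_max_image
    (Finset.univ.filter fun s : Fin (mult x A) => v ⟨A, s⟩ ≠ 0) id ⟨r, by simpa using hq⟩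
  simp only [Finset.mem_filter, Finset.mem_univ, true_and, id] at hs hmax
  have hzero : ∀ q : Fin (mult x A), s < q → v ⟨A, q⟩ = 0 := fun q h => by
    by_contra hne
    exact absurd (hmax q hne) (not_le.2 h)
  have hA : (A : ℂ) = c := by
    have h := hv ⟨A, s⟩
    rw [sum_blockD_mul, Finset.sum_eq_single s] at h
    · simpa [hs] using h
    · intro q _ hqs
      rcases lt_or_gt_of_ne hqs with h' | h'
      · rw [Nat.choose_eq_zero_of_lt h']; simp
      · rw [hzero q h', mul_zero]
    · simp
  -- If s > 0, the equation one place lower reads A v_{s-1} + s A v_s = c v_{s-1}; with A = c it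
  -- gives s A v_s = 0.
  have hs0 : (s : ℕ) = 0 := by
    by_contra h0
    let s' : Fin (mult x A) := ⟨s - 1, by omega⟩
    have hs' : (s' : ℕ) + 1 = s := by simp only [s']; omega
    have h := hv ⟨A, s'⟩
    rw [sum_blockD_mul, Fintype.sum_eq_add s' s (fun h => by rw [h] at hs'; omega)] at h
    · rw [← hs', Nat.choose_self, Nat.choose_succ_self_right, hA] at h
      have h' : ((s' : ℕ) + 1 : ℂ) * c * v ⟨A, s⟩ = 0 := by
        push_cast at h
        linear_combination h
      rw [← hA] at h'
      exact mul_ne_zero (mul_ne_zero (Nat.cast_add_one_ne_zero _) (expValues_ne_zero x A)) hs h'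
    · rintro q ⟨h1, h2⟩
      rcases lt_or_gt_of_ne h2 with h' | h'
      · have : (q : ℕ) < s' := by
          have : (q : ℕ) ≠ s' := fun h => h1 (Fin.ext h)
          have : (q : ℕ) < s := h'
          omega
        rw [Nat.choose_eq_zero_of_lt this]; simp
      · rw [hzero q h', mul_zero]
  have hr : (r : ℕ) ≤ s := hmax r hq
  exact ⟨hA, by simp only; omega⟩

/-- The relations among the S_q form a subspace stable under the transpose of `blockD x`. If
nonzero, it contains an eigenvector over ℂ, hence a multiple of a coordinate vector at some (A, 0),
and then S_(A,0) = 0. -/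
theorem linearIndependent_of_blockD {n : ℕ} {x : Fin n → ℂ} {V : Type*} [AddCommGroup V]
    [Module ℂ V] (T : Module.End ℂ V) (S : LocalIndex x → V)
    (hT : ∀ q, T (S q) = ∑ p, blockD x q p • S p)
    (h0 : ∀ (A : expValues x) (h : 0 < mult x A), S ⟨A, ⟨0, h⟩⟩ ≠ 0) :
    LinearIndependent ℂ S := by
  let Φ : (LocalIndex x → ℂ) →ₗ[ℂ] V := Fintype.linearCombination ℂ S
  let M : Module.End ℂ (LocalIndex x → ℂ) := (blockD x).transpose.mulVecLin
  have hM : ∀ v p, M v p = ∑ q, blockD x q p * v q := fun v p => rfl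
  have hΦ : ∀ v, Φ v = ∑ q, v q • S q := fun v => rfl
  have hcomm : ∀ v, Φ (M v) = T (Φ v) := fun v => by
    simp only [hΦ, hM, map_sum, map_smul, hT, Finset.sum_smul, Finset.smul_sum]
    rw [Finset.sum_comm]
    refine Finset.sum_congr rfl fun q _ => Finset.sum_congr rfl fun p _ => ?_
    rw [smul_smul, mul_comm]
  have hinv : ∀ v ∈ LinearMap.ker Φ, M v ∈ LinearMap.ker Φ := fun v hv => by
    rw [LinearMap.mem_ker] at hv ⊢
    rw [hcomm, hv, map_zero]
  have hker : LinearMap.ker Φ = ⊥ := by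
    by_contra hne
    have : Nontrivial (LinearMap.ker Φ) := Submodule.nontrivial_iff_ne_bot.2 hne
    obtain ⟨c, hc⟩ := Module.End.exists_eigenvalue (M.restrict hinv)
    obtain ⟨⟨v, hvK⟩, hv⟩ := hc.exists_hasEigenvector
    have hvne : v ≠ 0 := fun h => hv.2 (Subtype.ext h)
    have hMv : ∀ p, ∑ q, blockD x q p * v q = c * v p := fun p => by
      have := congrFun (congrArg Subtype.val hv.apply_eq_smul) p
      simpa [hM] using this
    obtain ⟨q, hq⟩ := Function.ne_iff.1 hvne
    obtain ⟨hqc, hq0⟩ := blockD_eigenvector hMv hq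
    have hsum : Φ v = v q • S q := by
      rw [hΦ, Fintype.sum_eq_single q]
      intro p hp
      by_cases hvp : v p = 0
      · rw [hvp, zero_smul]
      · obtain ⟨hpc, hp0⟩ := blockD_eigenvector hMv hvp
        refine absurd ?_ hp
        obtain ⟨A, r⟩ := q
        obtain ⟨B, s⟩ := p
        obtain rfl : B = A := Subtype.ext (hpc.trans hqc.symm)
        congr 1
        exact Fin.ext (hp0.trans hq0.symm)
    rw [LinearMap.mem_ker.1 hvK] at hsum
    obtain ⟨A, r⟩ := q
    have hr : r = ⟨0, r.pos⟩ := Fin.ext hq0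
    rw [hr] at hsum hq
    exact smul_ne_zero hq (h0 A r.pos) hsum.symm
  exact Fintype.linearIndependent_iff.2 fun g hg i =>
    congrFun ((LinearMap.ker_eq_bot'.1 hker) g hg) i

theorem card_localIndex {n : ℕ} (x : Fin n → ℂ) : Fintype.card (LocalIndex x) = n := by
  rw [Fintype.card_sigma]
  simp only [Fintype.card_fin]
  unfold mult
  rw [Finset.sum_coe_sort (expValues x)
    fun A => (Finset.univ.filter fun k => Complex.exp (twoPiI * x k) = A).card, expValues,
    ← Finset.card_eq_sum_card_image, Finset.card_univ, Fintype.card_fin]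

/-- The common last step for formal and holomorphic solutions: n independent vectors in a space of
dimension at most n. -/
theorem exists_basis_of_blockD {n : ℕ} {x : Fin n → ℂ} {V : Type*} [AddCommGroup V]
    [Module ℂ V] [Module.Finite ℂ V] (hV : Module.finrank ℂ V ≤ n)
    (T : Module.End ℂ V) (S : LocalIndex x → V)
    (hT : ∀ q, T (S q) = ∑ p, blockD x q p • S p)
    (h0 : ∀ (A : expValues x) (h : 0 < mult x A), S ⟨A, ⟨0, h⟩⟩ ≠ 0) :
    ∃ b : Module.Basis (LocalIndex x) ℂ V, (∀ q, b q = S q) ∧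
      LinearMap.toMatrix b b T = (blockD x).transpose := by
  have hli := linearIndependent_of_blockD T S hT h0
  have hcard : Fintype.card (LocalIndex x) = Module.finrank ℂ V :=
    le_antisymm hli.fintype_card_le_finrank (by rwa [card_localIndex])
  let b := Module.Basis.mk hli (hli.span_eq_top_of_card_eq_finrank' hcard).ge
  have hb : ∀ q, b q = S q := fun q => Module.Basis.mk_apply _ _ q
  refine ⟨b, hb, ?_⟩
  ext p q
  rw [LinearMap.toMatrix_apply, hb, hT, map_sum]
  simp_rw [← hb]
  simp [Finsupp.single_apply]

end

section

/-! ### Order of vanishing of the gamma product -/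

theorem card_le_analyticOrderAt_prod {ι : Type*} {h : ι → ℂ → ℂ} {a : ℂ} (s : Finset ι)
    (hh : ∀ i, AnalyticAt ℂ (h i) a) (h0 : ∀ i ∈ s, h i a = 0) :
    (s.card : ℕ∞) ≤ analyticOrderAt (∏ i ∈ s, h i) a := by
  classical
  induction s using Finset.induction_on with
  | empty => simp
  | insert i s hi ih =>
    rw [Finset.prod_insert hi, analyticOrderAt_mul (hh i) (Finset.analyticAt_prod _ fun j _ => hh j),
      Finset.card_insert_of_notMem hi, Nat.cast_add, add_comm, Nat.cast_one]
    refine add_le_add ?_ (ih fun j hj => h0 j (Finset.mem_insert_of_mem hj))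
    rw [Order.one_le_iff_ne_zero]
    exact (hh i).analyticOrderAt_ne_zero.2 (h0 i (Finset.mem_insert_self i s))

/-- Each factor vanishing at a adds at least one to the order of vanishing, and the remaining
factors cannot lower it. -/
theorem iteratedDeriv_prod_mul_eq_zero {ι : Type*} [Fintype ι] {h : ι → ℂ → ℂ} {g : ℂ → ℂ} {a : ℂ}
    (s : Finset ι) (hh : ∀ i, AnalyticAt ℂ (h i) a) (hg : AnalyticAt ℂ g a)
    (h0 : ∀ i ∈ s, h i a = 0) {k : ℕ} (hk : k < s.card) :
    iteratedDeriv k ((∏ i, h i) * g) a = 0 := by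
  classical
  have hp : ∀ t : Finset ι, AnalyticAt ℂ (∏ i ∈ t, h i) a := fun t =>
    Finset.analyticAt_prod _ fun j _ => hh j
  refine (natCast_le_analyticOrderAt_iff_iteratedDeriv_eq_zero ((hp _).mul hg)).1 ?_ k hk
  rw [← Finset.prod_mul_prod_compl s h, mul_assoc,
    analyticOrderAt_mul (hp _) ((hp _).mul hg)]
  exact (card_le_analyticOrderAt_prod s hh h0).trans le_self_add

theorem exp_nuMin {n : ℕ} (x : Fin n → ℂ) (A : expValues x) :
    Complex.exp (twoPiI * nuMin x A) = A := (exists_min_re x A).choose_spec.1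

theorem exp_nuMax {n : ℕ} (x : Fin n → ℂ) (A : expValues x) :
    Complex.exp (twoPiI * nuMax x A) = A := (exists_max_re x A).choose_spec.1

theorem eq_nuMin_add_nat {n : ℕ} {x : Fin n → ℂ} {A : expValues x} {i : Fin n}
    (hi : Complex.exp (twoPiI * x i) = A) : ∃ m : ℕ, x i = nuMin x A + m := by
  obtain ⟨k, hk⟩ := exp_twoPiI_eq_iff.1 (hi.trans (exp_nuMin x A).symm)
  have hre : (nuMin x A).re ≤ (x i).re := (exists_min_re x A).choose_spec.2 i hi
  have hk0 : 0 ≤ k := by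
    rw [hk] at hre
    simpa using hre
  lift k to ℕ using hk0
  exact ⟨k, by simpa using hk⟩

theorem eq_nuMax_sub_nat {n : ℕ} {x : Fin n → ℂ} {A : expValues x} {i : Fin n}
    (hi : Complex.exp (twoPiI * x i) = A) : ∃ m : ℕ, x i = nuMax x A - m := by
  obtain ⟨k, hk⟩ := exp_twoPiI_eq_iff.1 ((exp_nuMax x A).trans hi.symm)
  have hre : (x i).re ≤ (nuMax x A).re := (exists_max_re x A).choose_spec.2 i hi
  have hk0 : 0 ≤ k := by
    rw [hk] at hre
    simpa using hre
  lift k to ℕ using hk0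
  exact ⟨k, by rw [hk]; simp⟩

/-- The properties of the exponents `ν(A)` (at `0`: `σ = 1`, `x = α`) and `ν'(B)` (at `∞`: `σ = -1`,
`x = β`) from which the description of the local solutions follows. -/
structure IsLocalExponent (σ : ℤ) {n : ℕ} (α β x : Fin n → ℂ) (ν : expValues x → ℂ) : Prop where
  exp_eq : ∀ A, Complex.exp (twoPiI * ν A) = A
  vanish : ∀ A k, k < mult x A → ∀ j : ℕ,
    iteratedDeriv k (gammaProd α β) (ν A - σ * (j + 1)) = 0
  exists_ne_zero : ∀ A, ∃ l : ℕ, gammaProd α β (ν A + σ * l) ≠ 0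

theorem exists_nat_gt_norm_sub {ι : Type*} [Finite ι] (x : ι → ℂ) (a : ℂ) :
    ∃ L : ℕ, ∀ i, ‖x i - a‖ < L := by
  obtain ⟨M, hM⟩ := (Set.finite_range fun i => ‖x i - a‖).bddAbove
  obtain ⟨L, hL⟩ := exists_nat_gt M
  exact ⟨L, fun i => (hM ⟨i, rfl⟩).trans_lt hL⟩

theorem Gamma_ne_zero_of_forall_int {s : ℂ} (h : ∀ k : ℤ, s ≠ k) : Complex.Gamma s ≠ 0 :=
  Complex.Gamma_ne_zero fun m => by simpa using h (-m)

theorem isLocalExponent_zero {n : ℕ} {α β : Fin n → ℂ}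
    (hαβ : ∀ (i j : Fin n) (k : ℤ), α i ≠ β j + (k : ℂ)) :
    IsLocalExponent 1 α β α (nuMin α) where
  exp_eq := exp_nuMin α
  vanish A k hk j := by
    have hG : gammaProd α β = (∏ i, fun s => (Complex.Gamma (s - α i + 1))⁻¹) *
        fun s => ∏ i, (Complex.Gamma (-s + β i + 1))⁻¹ := by
      funext s
      rw [gammaProd_eq_prod_inv, Pi.mul_apply, Finset.prod_apply]
    have hΓ := Complex.differentiable_one_div_Gamma
    rw [hG]
    refine iteratedDeriv_prod_mul_eq_zero
      (Finset.univ.filter fun k => Complex.exp (twoPiI * α k) = A) (fun i => ?_) ?_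
      (fun i hi => ?_) hk
    · exact Differentiable.analyticAt
        (hΓ.comp (by fun_prop : Differentiable ℂ fun s => s - α i + 1)) _
    · exact Differentiable.analyticAt (Differentiable.fun_finsetProd fun i _ =>
        hΓ.comp (by fun_prop : Differentiable ℂ fun s => -s + β i + 1)) _
    -- With α_i = ν + m, the argument of Γ at ν - (j + 1) is -(m + j), a pole.
    · obtain ⟨m, hm⟩ := eq_nuMin_add_nat (Finset.mem_filter.1 hi).2
      rw [inv_eq_zero, Complex.Gamma_eq_zero_iff]
      exact ⟨m + j, by rw [hm]; push_cast; ring⟩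
  exists_ne_zero A := by
    -- At ν + L the arguments of the α-factors have positive real part, while those of the β-factors
    -- are never integers because α_i - β_j is not.
    obtain ⟨L, hL⟩ := exists_nat_gt_norm_sub α (nuMin α A)
    refine ⟨L, ?_⟩
    rw [gammaProd_eq_prod_inv]
    refine mul_ne_zero ?_ ?_ <;> refine Finset.prod_ne_zero_iff.2 fun i _ => inv_ne_zero ?_
    · refine Complex.Gamma_ne_zero_of_re_pos ?_
      have := (Complex.re_le_norm (α i - nuMin α A)).trans_lt (hL i)
      simp at this ⊢
      linarith
    · refine Gamma_ne_zero_of_forall_int fun k hk => hαβ (exists_min_re α A).choose i (1 - L - k) ?_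
      change nuMin α A = _
      push_cast at hk ⊢
      linear_combination -hk

theorem isLocalExponent_infty {n : ℕ} {α β : Fin n → ℂ}
    (hαβ : ∀ (i j : Fin n) (k : ℤ), α i ≠ β j + (k : ℂ)) :
    IsLocalExponent (-1) α β β (nuMax β) where
  exp_eq := exp_nuMax β
  vanish A k hk j := by
    have hG : gammaProd α β = (∏ i, fun s => (Complex.Gamma (-s + β i + 1))⁻¹) *
        fun s => ∏ i, (Complex.Gamma (s - α i + 1))⁻¹ := by
      funext s
      rw [gammaProd_eq_prod_inv, Pi.mul_apply, Finset.prod_apply, mul_comm]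
    have hΓ := Complex.differentiable_one_div_Gamma
    rw [hG]
    refine iteratedDeriv_prod_mul_eq_zero
      (Finset.univ.filter fun k => Complex.exp (twoPiI * β k) = A) (fun i => ?_) ?_
      (fun i hi => ?_) hk
    · exact Differentiable.analyticAt
        (hΓ.comp (by fun_prop : Differentiable ℂ fun s => -s + β i + 1)) _
    · exact Differentiable.analyticAt (Differentiable.fun_finsetProd fun i _ =>
        hΓ.comp (by fun_prop : Differentiable ℂ fun s => s - α i + 1)) _
    · obtain ⟨m, hm⟩ := eq_nuMax_sub_nat (Finset.mem_filter.1 hi).2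
      rw [inv_eq_zero, Complex.Gamma_eq_zero_iff]
      exact ⟨m + j, by rw [hm]; push_cast; ring⟩
  exists_ne_zero A := by
    obtain ⟨L, hL⟩ := exists_nat_gt_norm_sub β (nuMax β A)
    refine ⟨L, ?_⟩
    rw [gammaProd_eq_prod_inv]
    refine mul_ne_zero ?_ ?_ <;> refine Finset.prod_ne_zero_iff.2 fun i _ => inv_ne_zero ?_
    · refine Gamma_ne_zero_of_forall_int fun k hk =>
        hαβ i (exists_max_re β A).choose (1 - L - k) ?_
      change _ = nuMax β A + _
      push_cast at hk ⊢
      linear_combination -hk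
    · refine Complex.Gamma_ne_zero_of_re_pos ?_
      have := (neg_le_abs _).trans_lt ((Complex.abs_re_le_norm (β i - nuMax β A)).trans_lt (hL i))
      simp at this ⊢
      linarith

/-! ### The formal series as solutions -/

variable {σ : ℤ} {n : ℕ} {α β x : Fin n → ℂ} {ν : expValues x → ℂ}

theorem logCoeff_eq_zero (hν : IsLocalExponent σ α β x ν) {A : expValues x} {r : ℕ}
    (hr : r < mult x A) (j : ℕ) : logCoeff α β r (ν A - σ * (j + 1)) = 0 := by
  ext p
  rw [logCoeff_eq_leibnizPoly, leibnizPoly_coeff,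
    hν.vanish A _ ((Nat.sub_le r p).trans_lt hr), mul_zero, coeff_zero]

open Classical in
-- The terms against the direction σ vanish, so the one-sided series equals the two-sided one over ν
-- + ℤ. The condition on a is then invariant under a ↦ a - 1, and the recurrence has no boundary
-- term.
theorem formalSeries_apply (hσ : σ = 1 ∨ σ = -1) (hν : IsLocalExponent σ α β x ν)
    {A : expValues x} {r : ℕ} (hr : r < mult x A) (a : ℂ) :
    (formalSeries σ α β (ν A) r).1 a =
      if Complex.exp (twoPiI * a) = A then logCoeff α β r a else 0 := by
  have hA := hν.exp_eq A
  change (if ∃ l : ℕ, a = ν A + (σ : ℂ) * l then logCoeff α β r a else 0) = _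
  by_cases h1 : ∃ l : ℕ, a = ν A + (σ : ℂ) * l
  · rw [if_pos h1, if_pos]
    obtain ⟨l, rfl⟩ := h1
    rw [← hA]
    exact exp_twoPiI_eq_iff.2 ⟨σ * l, by push_cast; rfl⟩
  · rw [if_neg h1]
    split_ifs with h2
    · obtain ⟨k, rfl⟩ := exp_twoPiI_eq_iff.1 (h2.trans hA.symm)
      have hk : σ * k < 0 := by
        by_contra! hk
        refine h1 ⟨(σ * k).toNat, ?_⟩
        have e : (((σ * k).toNat : ℤ) : ℂ) = ((σ * k : ℤ) : ℂ) := by rw [Int.toNat_of_nonneg hk]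
        rw [Int.cast_natCast] at e
        rw [e]
        rcases hσ with rfl | rfl <;> simp
      obtain ⟨j, hj⟩ : ∃ j : ℕ, k = -(σ * (j + 1)) := by
        refine ⟨(-(σ * k) - 1).toNat, ?_⟩
        rw [Int.toNat_of_nonneg (by omega)]
        rcases hσ with rfl | rfl <;> ring
      rw [hj, ← logCoeff_eq_zero hν hr j]
      congr 1
      push_cast
      ring
    · rfl

theorem formalSeries_mem (hσ : σ = 1 ∨ σ = -1) (hν : IsLocalExponent σ α β x ν)
    {A : expValues x} {r : ℕ} (hr : r < mult x A) :
    formalSeries σ α β (ν A) r ∈ formalSolutions σ α β := by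
  rw [mem_formalSolutions_iff]
  intro a
  have h := exp_twoPiI_int_mul_add (-1) a
  rw [Int.cast_neg, Int.cast_one, ← sub_eq_add_neg] at h
  rw [formalSeries_apply hσ hν hr, formalSeries_apply hσ hν hr, h]
  split_ifs
  · exact logCoeff_recurrence α β r a
  · simp

theorem sum_blockD_smul {V : Type*} [AddCommGroup V] [Module ℂ V] (F : expValues x → ℕ → V)
    (A : expValues x) (r : Fin (mult x A)) :
    ∑ p, blockD x ⟨A, r⟩ p • F p.1 p.2 =
      ∑ s ∈ Finset.range (r + 1), ((r : ℕ).choose s : ℂ) • (A : ℂ) • F A s := by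
  rw [Fintype.sum_sigma, Finset.sum_eq_single A]
  · simp_rw [blockD_diag, mul_smul]
    rw [Fin.sum_univ_eq_sum_range fun s => ((r : ℕ).choose s : ℂ) • (A : ℂ) • F A s]
    symm
    refine Finset.sum_subset (Finset.range_subset_range.2 r.2) fun s _ hs => ?_
    rw [Nat.choose_eq_zero_of_lt (by simpa using hs)]
    simp
  · intro B _ hB
    refine Finset.sum_eq_zero fun q _ => ?_
    rw [blockD, if_neg fun h => hB h.1.symm, zero_smul]
  · simp

theorem formalDeck_formalSeries (hσ : σ = 1 ∨ σ = -1) (hν : IsLocalExponent σ α β x ν)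
    (q : LocalIndex x) :
    formalDeck σ 1 (formalSeries σ α β (ν q.1) q.2) =
      ∑ p, blockD x q p • formalSeries σ α β (ν p.1) p.2 := by
  obtain ⟨A, r⟩ := q
  rw [sum_blockD_smul (fun B s => formalSeries σ α β (ν B) s)]
  refine Subtype.ext (funext fun a => ?_)
  rw [Submodule.coe_sum, Finset.sum_apply]
  change Complex.exp (twoPiI * (1 : ℤ) * a) •
    ((formalSeries σ α β (ν A) r).1 a).comp (X + C (twoPiI * (1 : ℤ))) =
    ∑ s ∈ Finset.range (r + 1), ((r : ℕ).choose s : ℂ) • (A : ℂ) • (formalSeries σ α β (ν A) s).1 a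
  rw [formalSeries_apply hσ hν r.2, Int.cast_one, mul_one]
  have h : ∀ s ∈ Finset.range ((r : ℕ) + 1), s < mult x A := fun s hs =>
    (Nat.lt_succ_iff.1 (Finset.mem_range.1 hs)).trans_lt r.2
  rw [Finset.sum_congr rfl fun s hs => by rw [formalSeries_apply hσ hν (h s hs)]]
  split_ifs with ha
  · rw [logCoeff_eq_leibnizPoly, leibnizPoly_comp_add (gammaProd_differentiable α β), ha,
      Finset.smul_sum]
    exact Finset.sum_congr rfl fun s _ => smul_comm _ _ _
  · simp

theorem formalSeries_zero_ne_zero (hν : IsLocalExponent σ α β x ν) (A : expValues x) :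
    formalSeries σ α β (ν A) 0 ≠ 0 := by
  classical
  obtain ⟨l, hl⟩ := hν.exists_ne_zero A
  intro h
  have h1 := congrFun (congrArg Subtype.val h) (ν A + σ * l)
  change (if ∃ m : ℕ, ν A + (σ : ℂ) * l = ν A + (σ : ℂ) * m then _ else _) = (0 : ℂ[X]) at h1
  rw [if_pos ⟨l, rfl⟩] at h1
  have h2 := congrArg (fun p => coeff p 0) h1
  rw [logCoeff_eq_leibnizPoly] at h2
  simp only [leibnizPoly_coeff] at h2
  simp at h2
  exact hl h2

end

section

/-! ### The dimension of the space of formal solutions -/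

/-- For a ≠ 0 the leading term of a • p survives, since p' has smaller degree. -/
theorem mem_degreeLT_of_shiftedDeriv {a : ℂ} {p : ℂ[X]} {m : ℕ} (ha : a ≠ 0)
    (h : shiftedDeriv a p ∈ degreeLT ℂ m) : p ∈ degreeLT ℂ m := by
  rcases eq_or_ne p 0 with rfl | hp
  · exact Submodule.zero_mem _
  rw [mem_degreeLT] at h ⊢
  rwa [shiftedDeriv_apply, degree_add_eq_left_of_degree_lt, degree_smul_of_smul_regular _
    (IsSMulRegular.of_ne_zero ha)] at h
  rw [degree_smul_of_smul_regular _ (IsSMulRegular.of_ne_zero ha)]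
  exact degree_derivative_lt hp

theorem mem_degreeLT_succ_of_shiftedDeriv {a : ℂ} {p : ℂ[X]} {m : ℕ}
    (h : shiftedDeriv a p ∈ degreeLT ℂ m) : p ∈ degreeLT ℂ (m + 1) := by
  rcases eq_or_ne a 0 with rfl | ha
  · rw [shiftedDeriv_apply, zero_smul, zero_add] at h
    rw [mem_degreeLT, degree_lt_iff_coeff_zero] at h ⊢
    intro k hk
    obtain ⟨k, rfl⟩ : ∃ j, k = j + 1 := ⟨k - 1, by omega⟩
    have := h k (by omega)
    rw [coeff_derivative] at this
    exact (mul_eq_zero.1 this).resolve_right (Nat.cast_add_one_ne_zero k)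
  · exact degreeLT_mono (Nat.le_succ m) (mem_degreeLT_of_shiftedDeriv ha h)

theorem aeval_shiftedDeriv_X_sub_C (a b : ℂ) :
    aeval (shiftedDeriv a) (X - C b) = shiftedDeriv (a - b) := by
  rw [map_sub, aeval_X, aeval_C, shiftedDeriv, shiftedDeriv, map_sub]
  abel

open Classical in
-- Undoing the factors one at a time, each resonant one (x_i = a) costs one degree and the others
-- cost nothing.
theorem mem_degreeLT_of_aeval_prod {ι : Type*} (s : Finset ι) (x : ι → ℂ) {a : ℂ} {p : ℂ[X]} {m : ℕ}
    (h : aeval (shiftedDeriv a) (∏ i ∈ s, (X - C (x i))) p ∈ degreeLT ℂ m) :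
    p ∈ degreeLT ℂ (m + (s.filter fun i => x i = a).card) := by
  induction s using Finset.induction_on generalizing p m with
  | empty => simpa using h
  | insert i s hi ih =>
    rw [Finset.prod_insert hi, map_mul, Module.End.mul_apply, aeval_shiftedDeriv_X_sub_C] at h
    rw [Finset.filter_insert]
    split_ifs with hx
    · rw [Finset.card_insert_of_notMem (by simp [hi])]
      have := ih (mem_degreeLT_succ_of_shiftedDeriv h)
      rwa [add_assoc, add_comm 1] at this
    · exact ih (mem_degreeLT_of_shiftedDeriv (sub_ne_zero.2 fun h => hx h.symm) h)

theorem aeval_shiftedDeriv_mem_degreeLT (q : ℂ[X]) {a : ℂ} {p : ℂ[X]} {m : ℕ}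
    (h : p ∈ degreeLT ℂ m) : aeval (shiftedDeriv a) q p ∈ degreeLT ℂ m := by
  induction q using Polynomial.induction_on generalizing p with
  | C c => simpa using Submodule.smul_mem _ c h
  | add q q' hq hq' => rw [map_add]; exact Submodule.add_mem _ (hq h) (hq' h)
  | monomial k c ih =>
    rw [pow_succ, ← mul_assoc, map_mul, aeval_X, Module.End.mul_apply]
    refine ih ?_
    rw [shiftedDeriv_apply]
    refine Submodule.add_mem _ (Submodule.smul_mem _ a h) ?_
    rw [mem_degreeLT] at h ⊢
    exact (degree_derivative_le).trans_lt h

theorem eq_zero_of_aeval_prod {ι : Type*} [Fintype ι] {x : ι → ℂ} {a : ℂ} {p : ℂ[X]}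
    (hx : ∀ i, x i ≠ a) (h : aeval (shiftedDeriv a) (∏ i, (X - C (x i))) p = 0) : p = 0 := by
  classical
  have := mem_degreeLT_of_aeval_prod Finset.univ x (m := 0) (by rw [h]; exact Submodule.zero_mem _)
  rw [Finset.filter_false_of_mem fun i _ => hx i, Finset.card_empty, mem_degreeLT] at this
  simpa using this

variable {σ : ℤ} {n : ℕ} {x y : Fin n → ℂ}

/-- A formal series vanishes far enough against the direction of its progressions. -/
theorem exists_forall_sub_eq_zero (hσ : σ = 1 ∨ σ = -1) (f : FormalLog σ) (a : ℂ) :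
    ∃ K : ℕ, ∀ k : ℕ, K ≤ k → f.1 (a - σ * k) = 0 := by
  obtain ⟨T, N, hf⟩ := f.2
  obtain ⟨K, hK⟩ := exists_nat_gt_norm_sub (fun c : T => (c : ℂ)) a
  refine ⟨K, fun k hk => ?_⟩
  by_contra hne
  obtain ⟨c, hc, l, hl⟩ := (hf _ hne).1
  -- From a - σk = c + σl the distance from c to a is k + l, too large once k ≥ K.
  have h1 : ‖c - a‖ = ((k + l : ℕ) : ℝ) := by
    rw [← Complex.norm_natCast]
    push_cast
    rcases hσ with rfl | rfl
    · rw [← norm_neg]; congr 1; push_cast at hl; linear_combination hl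
    · congr 1; push_cast at hl; linear_combination -hl
  have h2 := hK ⟨c, hc⟩
  rw [h1] at h2
  have : k + l < K := by exact_mod_cast h2
  omega

open Classical in
-- The resonances at distinct exponents are disjoint sets of indices, all of class A.
theorem sum_card_filter_le_mult (hσ : σ = 1 ∨ σ = -1) {a₀ : ℂ} (A : expValues x)
    (hA : Complex.exp (twoPiI * a₀) = A) (l : ℕ) :
    ∑ j ∈ Finset.range l, (Finset.univ.filter fun i => x i = a₀ + σ * (j + 1)).card ≤ mult x A := by
  rw [← Finset.card_biUnion]
  · unfold mult
    refine Finset.card_le_card fun i hi => ?_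
    obtain ⟨j, -, hj⟩ := Finset.mem_biUnion.1 hi
    refine Finset.mem_filter.2 ⟨Finset.mem_univ _, ?_⟩
    rw [(Finset.mem_filter.1 hj).2, ← hA]
    exact exp_twoPiI_eq_iff.2 ⟨σ * (j + 1), by push_cast; rfl⟩
  · intro j _ k _ hjk
    refine Finset.disjoint_left.2 fun i hj hk => hjk ?_
    have h := (Finset.mem_filter.1 hj).2.symm.trans (Finset.mem_filter.1 hk).2
    rcases hσ with rfl | rfl
    · push_cast at h
      exact_mod_cast (by linear_combination h : (j : ℂ) = k)
    · push_cast at h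
      exact_mod_cast (by linear_combination -h : (j : ℂ) = k)

/-! ### Propagation of coefficients along the recurrence -/

variable {c : ℂ} {f : ℂ → ℂ[X]}

/-- The recurrence of the formal equation, with exponents `x` in the direction `σ`. -/
def SatisfiesRecurrence (σ : ℤ) (x y : Fin n → ℂ) (c : ℂ) (f : ℂ → ℂ[X]) : Prop :=
  ∀ a, aeval (shiftedDeriv a) (∏ i, (X - C (x i))) (f a) =
    c • aeval (shiftedDeriv (a - σ)) (∏ j, (X - C (y j))) (f (a - σ))

open Classical in
theorem SatisfiesRecurrence.mem_degreeLT (hf : SatisfiesRecurrence σ x y c f) {a₀ : ℂ}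
    (h0 : f a₀ = 0) (l : ℕ) : f (a₀ + σ * l) ∈ degreeLT ℂ
      (∑ j ∈ Finset.range l, (Finset.univ.filter fun i => x i = a₀ + σ * (j + 1)).card) := by
  induction l with
  | zero => simp [h0]
  | succ l ih =>
    rw [Finset.sum_range_succ]
    push_cast
    refine mem_degreeLT_of_aeval_prod _ x ?_
    rw [hf, show a₀ + σ * (l + 1) - (σ : ℂ) = a₀ + σ * l by ring]
    exact Submodule.smul_mem _ c (aeval_shiftedDeriv_mem_degreeLT _ ih)

theorem SatisfiesRecurrence.forward (hf : SatisfiesRecurrence σ x y c f) {a₀ : ℂ}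
    (h0 : f a₀ = 0) (hx : ∀ (l : ℕ) i, x i ≠ a₀ + σ * (l + 1)) (l : ℕ) : f (a₀ + σ * l) = 0 := by
  induction l with
  | zero => simpa using h0
  | succ l ih =>
    push_cast
    refine eq_zero_of_aeval_prod (hx l) ?_
    rw [hf, show a₀ + σ * (l + 1) - (σ : ℂ) = a₀ + σ * l by ring, ih, map_zero, smul_zero]

theorem SatisfiesRecurrence.backward (hf : SatisfiesRecurrence σ x y c f) (hc : c ≠ 0) {a₀ : ℂ}
    (h0 : f a₀ = 0) (hy : ∀ (l : ℕ) j, y j ≠ a₀ - σ * (l + 1)) (l : ℕ) : f (a₀ - σ * l) = 0 := by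
  induction l with
  | zero => simpa using h0
  | succ l ih =>
    push_cast
    refine eq_zero_of_aeval_prod (hy l) ?_
    have := hf (a₀ - σ * l)
    rw [ih, map_zero, show a₀ - σ * l - (σ : ℂ) = a₀ - σ * (l + 1) by ring] at this
    exact (smul_eq_zero.1 this.symm).resolve_left hc

/-- In each class of exponents there is one beyond which the recurrence is regular. -/
theorem exists_regular_exponent (hσ : σ = 1 ∨ σ = -1) (A : expValues x) :
    ∃ a : ℂ, Complex.exp (twoPiI * a) = A ∧ ∀ (l : ℕ) i, x i ≠ a + σ * (l + 1) := by
  obtain ⟨L, hL⟩ := exists_nat_gt_norm_sub x (nuMin x A)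
  refine ⟨nuMin x A + σ * L, ?_, fun l i hi => ?_⟩
  · rw [← exp_nuMin x A]
    exact exp_twoPiI_eq_iff.2 ⟨σ * L, by push_cast; rfl⟩
  · have h1 : ‖x i - nuMin x A‖ = ((L + l + 1 : ℕ) : ℝ) := by
      rw [← Complex.norm_natCast]
      rcases hσ with rfl | rfl
      · congr 1; push_cast at hi ⊢; linear_combination hi
      · rw [← norm_neg]; congr 1; push_cast at hi ⊢; linear_combination -hi
    have h2 := hL i
    rw [h1] at h2
    have : L + l + 1 < L := by exact_mod_cast h2
    omega

theorem exists_nat_of_exp_eq (hσ : σ = 1 ∨ σ = -1) {a b : ℂ}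
    (h : Complex.exp (twoPiI * a) = Complex.exp (twoPiI * b)) :
    ∃ l : ℕ, a = b + σ * l ∨ a = b - σ * l := by
  obtain ⟨k, rfl⟩ := exp_twoPiI_eq_iff.1 h
  obtain ⟨l, rfl | rfl⟩ := k.eq_nat_or_neg <;> rcases hσ with rfl | rfl <;> refine ⟨l, ?_⟩ <;>
    simp [sub_eq_add_neg]

/-- A solution is determined by m_A constants per class: the coefficients of its polynomial at one
exponent of the class beyond all resonances. -/
theorem finrank_le_of_recurrence (hσ : σ = 1 ∨ σ = -1) (hc : c ≠ 0)
    (hxy : ∀ i j (k : ℤ), x i ≠ y j + k) (W : Submodule ℂ (FormalLog σ))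
    (hW : ∀ f ∈ W, SatisfiesRecurrence σ x y c f.1) :
    Module.Finite ℂ W ∧ Module.finrank ℂ W ≤ n := by
  choose a ha hreg using fun A => exists_regular_exponent (x := x) hσ A
  let Ψ : W →ₗ[ℂ] (LocalIndex x → ℂ) := LinearMap.pi fun p =>
    lcoeff ℂ (p.2 : ℕ) ∘ₗ logCoeffAt σ (a p.1) ∘ₗ W.subtype
  have hΨ : ∀ f p, Ψ f p = (f.1.1 (a p.1)).coeff p.2 := fun f p => rfl
  have hinj : Function.Injective Ψ := by
    rw [injective_iff_map_eq_zero]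
    rintro ⟨f, hfW⟩ hf
    have hrec := hW f hfW
    -- Counting from a vanishing coefficient K steps back, all resonances met on the way are of
    -- class A, so the polynomial has degree less than m_A and `Ψ` sees all of it.
    have hbase : ∀ A, f.1 (a A) = 0 := fun A => by
      obtain ⟨K, hK⟩ := exists_forall_sub_eq_zero hσ f (a A)
      have hdeg := hrec.mem_degreeLT (hK K le_rfl) K
      rw [sub_add_cancel] at hdeg
      have hdeg' := degreeLT_mono (sum_card_filter_le_mult hσ A (by
        rw [← ha A]
        exact exp_twoPiI_eq_iff.2 ⟨-(σ * K), by push_cast; ring⟩) K) hdeg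
      rw [mem_degreeLT, degree_lt_iff_coeff_zero] at hdeg'
      ext r
      rcases lt_or_ge r (mult x A) with hr | hr
      · exact (hΨ _ _).symm.trans (congrFun hf ⟨A, ⟨r, hr⟩⟩)
      · exact hdeg' r hr
    refine Subtype.ext (Subtype.ext (funext fun b => ?_))
    change f.1 b = 0
    by_cases hb : Complex.exp (twoPiI * b) ∈ expValues x
    · let A : expValues x := ⟨_, hb⟩
      obtain ⟨i, -, hi⟩ := Finset.mem_image.1 hb
      obtain ⟨l, hl | hl⟩ := exists_nat_of_exp_eq (σ := σ) hσ (ha A).symm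
      · rw [hl]
        exact hrec.forward (hbase A) (hreg A) l
      · rw [hl]
        -- A resonance with some y_j on the way back would make y_j differ by an integer from an x_i
        -- of class A.
        refine hrec.backward hc (hbase A) (fun l j hj => ?_) l
        obtain ⟨k, hk⟩ := exp_twoPiI_eq_iff.1 (hi.trans (ha A).symm)
        refine hxy i j (k + σ * (l + 1)) ?_
        rw [hk, hj]
        push_cast
        ring
    -- Off the classes of x there are no resonances at all, so zero propagates forward from far
    -- back.
    · obtain ⟨K, hK⟩ := exists_forall_sub_eq_zero hσ f b
      have := hrec.forward (hK K le_rfl) (fun l i hi => hb ?_) K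
      · rwa [sub_add_cancel] at this
      · refine Finset.mem_image.2 ⟨i, Finset.mem_univ _, ?_⟩
        rw [hi]
        exact exp_twoPiI_eq_iff.2 ⟨σ * (l + 1 - K), by push_cast; ring⟩
  refine ⟨Module.Finite.of_injective Ψ hinj, ?_⟩
  have := LinearMap.finrank_le_finrank_of_injective hinj
  rwa [Module.finrank_fintype_fun_eq_card, card_localIndex] at this

theorem finrank_formalSolutions_zero {α β : Fin n → ℂ}
    (hαβ : ∀ (i j : Fin n) (k : ℤ), α i ≠ β j + (k : ℂ)) :
    Module.Finite ℂ (formalSolutions 1 α β) ∧ Module.finrank ℂ (formalSolutions 1 α β) ≤ n := by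
  refine finrank_le_of_recurrence (c := (-1) ^ n) (Or.inl rfl) (by simp) hαβ _ fun f hf a => ?_
  rw [Int.cast_one, ← mem_formalSolutions_iff.1 hf a, smul_smul, ← mul_pow]
  simp

theorem finrank_formalSolutions_infty {α β : Fin n → ℂ}
    (hαβ : ∀ (i j : Fin n) (k : ℤ), α i ≠ β j + (k : ℂ)) :
    Module.Finite ℂ (formalSolutions (-1) α β) ∧
      Module.finrank ℂ (formalSolutions (-1) α β) ≤ n := by
  refine finrank_le_of_recurrence (x := β) (y := α) (c := (-1) ^ n) (Or.inr rfl) (by simp)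
    (fun i j k h => hαβ j i (-k) (by rw [h]; push_cast; ring)) _ fun f hf a => ?_
  -- Read at a + 1, the equation expresses the coefficient at a through the one at a + 1, with β as
  -- the resonant exponents.
  have := mem_formalSolutions_iff.1 hf (a + 1)
  rw [add_sub_cancel_right] at this
  rw [Int.cast_neg, Int.cast_one, sub_neg_eq_add, this]

/-! ### Formal bases -/

/-- The turn here is positive around 0 for both values of σ; at ∞ the matrix is inverted afterwards.
-/
theorem exists_formal_basis {α β : Fin n → ℂ} {ν : expValues x → ℂ} (hσ : σ = 1 ∨ σ = -1)
    (hν : IsLocalExponent σ α β x ν)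
    (hfin : Module.Finite ℂ (formalSolutions σ α β) ∧
      Module.finrank ℂ (formalSolutions σ α β) ≤ n) :
    ∃ b : Module.Basis (LocalIndex x) ℂ (formalSolutions σ α β),
      (∀ i, (b i : FormalLog σ) = formalSeries σ α β (ν i.1) (i.2 : ℕ)) ∧
      LinearMap.toMatrix b b ((formalDeck σ 1).restrict (mem_ker_of_commute
        (hypOp_commute (formalDeck_commute_D σ 1) (formalDeck_commute_Z σ 1) α β))) =
        (blockD x).transpose := by
  have := hfin.1
  let T := (formalDeck σ 1).restrict (mem_ker_of_commute
    (hypOp_commute (formalDeck_commute_D σ 1) (formalDeck_commute_Z σ 1) α β))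
  let S : LocalIndex x → formalSolutions σ α β := fun q => ⟨_, formalSeries_mem hσ hν q.2.2⟩
  have hT : ∀ q, T (S q) = ∑ p, blockD x q p • S p := fun q => Subtype.ext <| by
    rw [Submodule.coe_sum]
    exact formalDeck_formalSeries hσ hν q
  obtain ⟨b, hb, hM⟩ := exists_basis_of_blockD hfin.2 T S hT
    fun A h h0 => formalSeries_zero_ne_zero hν A (congrArg Subtype.val h0)
  exact ⟨b, fun i => by rw [hb], hM⟩

theorem formalDeck_neg_mul (σ : ℤ) (k : ℤ) : formalDeck σ (-k) * formalDeck σ k = 1 := by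
  refine LinearMap.ext fun f => Subtype.ext (funext fun a => ?_)
  change Complex.exp (twoPiI * (-k : ℤ) * a) • (Complex.exp (twoPiI * k * a) •
    (f.1 a).comp (X + C (twoPiI * k))).comp (X + C (twoPiI * (-k : ℤ))) = f.1 a
  rw [smul_comp, smul_smul, ← Complex.exp_add, comp_assoc]
  simp [add_assoc]

end

section

/-! ### Sums of formal logarithmic series -/

section Expansion

variable {σ : ℤ} {V : Opens ℂ}

/-- The value at `z = exp u` of the term with exponent `a` of a formal logarithmic series. -/
def logTerm (f : FormalLog σ) (u a : ℂ) : ℂ := Complex.exp (a * u) * (f.1 a).eval u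

/-- Locally normal convergence of a formal logarithmic series on `logCover V`. -/
def NormallyConvergent (V : Opens ℂ) (f : FormalLog σ) : Prop :=
  ∀ u ∈ logCover V, ∃ U : Set ℂ, IsOpen U ∧ u ∈ U ∧ U ⊆ logCover V ∧
    ∃ B : ℂ → ℝ, Summable B ∧ ∀ a, ∀ w ∈ U, ‖logTerm f w a‖ ≤ B a

/-- The formal series `f` converges locally normally to `F`. -/
structure LogExpands (f : FormalLog σ) (F : Hol V) : Prop where
  normal : NormallyConvergent V f
  hasSum : ∀ u ∈ logCover V, HasSum (logTerm f u) (F.1 u)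

theorem differentiable_logTerm (f : FormalLog σ) (a : ℂ) :
    Differentiable ℂ fun u => logTerm f u a :=
  Differentiable.fun_mul (by fun_prop) (f.1 a).differentiable

theorem Hol.ext_on {F G : Hol V} (h : ∀ u ∈ logCover V, F.1 u = G.1 u) : F = G := by
  refine Subtype.ext (funext fun u => ?_)
  by_cases hu : u ∈ logCover V
  · exact h u hu
  · rw [F.2.2 u hu, G.2.2 u hu]

theorem LogExpands.unique {f : FormalLog σ} {F G : Hol V} (hF : LogExpands f F)
    (hG : LogExpands f G) : F = G :=
  Hol.ext_on fun u hu => (hF.hasSum u hu).unique (hG.hasSum u hu)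

theorem logExpands_zero : LogExpands (0 : FormalLog σ) (0 : Hol V) where
  normal u hu := ⟨logCover V, (logCover V).2, hu, subset_rfl, 0, summable_zero, fun a w _ => by
    simp [logTerm]⟩
  hasSum u _ := by
    have : logTerm (0 : FormalLog σ) u = 0 := by funext a; simp [logTerm]
    rw [this]
    exact hasSum_zero

theorem LogExpands.add {f g : FormalLog σ} {F G : Hol V} (hf : LogExpands f F)
    (hg : LogExpands g G) : LogExpands (f + g) (F + G) := by
  have key : ∀ u a, logTerm (f + g) u a = logTerm f u a + logTerm g u a := fun u a => by
    simp [logTerm, mul_add]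
  refine ⟨fun u hu => ?_, fun u hu => ?_⟩
  · obtain ⟨U, hU, huU, hUV, B, hB, hfB⟩ := hf.normal u hu
    obtain ⟨U', hU', huU', -, B', hB', hgB'⟩ := hg.normal u hu
    refine ⟨U ∩ U', hU.inter hU', ⟨huU, huU'⟩, fun w hw => hUV hw.1, B + B', hB.add hB',
      fun a w hw => ?_⟩
    rw [key]
    exact (norm_add_le _ _).trans (add_le_add (hfB a w hw.1) (hgB' a w hw.2))
  · rw [funext (key u)]
    exact (hf.hasSum u hu).add (hg.hasSum u hu)

theorem LogExpands.smul {f : FormalLog σ} {F : Hol V} (hf : LogExpands f F) (c : ℂ) :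
    LogExpands (c • f) (c • F) := by
  have key : ∀ u a, logTerm (c • f) u a = c * logTerm f u a := fun u a => by
    simp [logTerm, mul_left_comm]
  refine ⟨fun u hu => ?_, fun u hu => ?_⟩
  · obtain ⟨U, hU, huU, hUV, B, hB, hfB⟩ := hf.normal u hu
    refine ⟨U, hU, huU, hUV, fun a => ‖c‖ * B a, hB.mul_left _, fun a w hw => ?_⟩
    rw [key, norm_mul]
    exact mul_le_mul_of_nonneg_left (hfB a w hw) (norm_nonneg _)
  · rw [funext (key u)]
    exact (hf.hasSum u hu).mul_left c

theorem LogExpands.sub {f g : FormalLog σ} {F G : Hol V} (hf : LogExpands f F)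
    (hg : LogExpands g G) : LogExpands (f - g) (F - G) := by
  have := hf.add (hg.smul (-1))
  have e1 : f + (-1 : ℂ) • g = f - g := by module
  have e2 : F + (-1 : ℂ) • G = F - G := by module
  rwa [e1, e2] at this

theorem LogExpands.sum {ι : Type*} {f : ι → FormalLog σ} {F : ι → Hol V} (s : Finset ι)
    (h : ∀ i, LogExpands (f i) (F i)) : LogExpands (∑ i ∈ s, f i) (∑ i ∈ s, F i) := by
  classical
  induction s using Finset.induction_on with
  | empty => exact logExpands_zero
  | insert i s hi ih =>
    rw [Finset.sum_insert hi, Finset.sum_insert hi]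
    exact (h i).add ih

theorem logTerm_formalD (f : FormalLog σ) (u a : ℂ) :
    logTerm (formalD σ f) u a = deriv (fun w => logTerm f w a) u := by
  have h1 : HasDerivAt (fun w : ℂ => Complex.exp (a * w)) (Complex.exp (a * u) * (a * 1)) u :=
    ((hasDerivAt_id u).const_mul a).cexp
  have h2 := h1.mul ((f.1 a).hasDerivAt u)
  rw [show (fun w => logTerm f w a) =
    (fun w : ℂ => Complex.exp (a * w)) * fun w => (f.1 a).eval w from rfl, h2.deriv]
  change Complex.exp (a * u) * (a • f.1 a + derivative (f.1 a)).eval u = _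
  rw [eval_add, eval_smul, smul_eq_mul]
  ring

/-- Cauchy's estimate on circles of half the radius of a ball in U keeps the convergence normal
after differentiation. -/
theorem LogExpands.holD {f : FormalLog σ} {F : Hol V} (hf : LogExpands f F) :
    LogExpands (formalD σ f) (holD V F) := by
  refine ⟨fun u hu => ?_, fun u hu => ?_⟩
  · obtain ⟨U, hU, huU, hUV, B, hB, hfB⟩ := hf.normal u hu
    obtain ⟨ε, hε, hball⟩ := Metric.isOpen_iff.1 hU u huU
    have hε2 : 0 < ε / 2 := half_pos hε
    refine ⟨Metric.ball u (ε / 2), Metric.isOpen_ball, Metric.mem_ball_self hε2,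
      ((Metric.ball_subset_ball (half_le_self hε.le)).trans hball).trans hUV,
      fun a => B a / (ε / 2), hB.div_const _, fun a w hw => ?_⟩
    rw [logTerm_formalD]
    refine Complex.norm_deriv_le_of_forall_mem_sphere_norm_le hε2
      (differentiable_logTerm f a).diffContOnCl fun z hz => hfB a z (hball ?_)
    rw [Metric.mem_ball] at hw ⊢
    rw [Metric.mem_sphere] at hz
    linarith [dist_triangle z w u]
  · obtain ⟨U, hU, huU, hUV, B, hB, hfB⟩ := hf.normal u hu
    have h := Complex.hasSum_deriv_of_summable_norm (F := fun a w => logTerm f w a) hB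
      (fun a => (differentiable_logTerm f a).differentiableOn) hU hfB huU
    have heq : (fun w => ∑' a, logTerm f w a) =ᶠ[nhds u] F.1 := by
      filter_upwards [hU.mem_nhds huU] with w hw
      exact (hf.hasSum w (hUV hw)).tsum_eq
    rw [heq.deriv_eq] at h
    have hD : (Hypergeom.holD V F).1 u = deriv F.1 u := if_pos hu
    rw [hD, funext fun a => logTerm_formalD f u a]
    exact h

theorem logTerm_formalZ (f : FormalLog σ) (u a : ℂ) :
    logTerm (formalZ σ f) u a = Complex.exp u * logTerm f u (a - 1) := by
  change Complex.exp (a * u) * (f.1 (a - 1)).eval u =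
    Complex.exp u * (Complex.exp ((a - 1) * u) * (f.1 (a - 1)).eval u)
  rw [← mul_assoc, ← Complex.exp_add]
  congr 2
  ring

theorem LogExpands.holZ {f : FormalLog σ} {F : Hol V} (hf : LogExpands f F) :
    LogExpands (formalZ σ f) (holZ V F) := by
  refine ⟨fun u hu => ?_, fun u hu => ?_⟩
  · obtain ⟨U, hU, huU, hUV, B, hB, hfB⟩ := hf.normal u hu
    refine ⟨U ∩ {w | ‖Complex.exp w‖ < ‖Complex.exp u‖ + 1},
      hU.inter (isOpen_lt (by fun_prop) continuous_const), ⟨huU, lt_add_one ‖Complex.exp u‖⟩,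
      fun w hw => hUV hw.1, fun a => (‖Complex.exp u‖ + 1) * B (a - 1),
      ((Equiv.subRight (1 : ℂ)).summable_iff.2 hB).mul_left _, fun a w hw => ?_⟩
    rw [logTerm_formalZ, norm_mul]
    exact mul_le_mul (le_of_lt hw.2) (hfB _ w hw.1) (norm_nonneg _) (by positivity)
  · rw [funext fun a => logTerm_formalZ f u a]
    exact ((Equiv.subRight (1 : ℂ)).hasSum_iff.2 (hf.hasSum u hu)).mul_left _

theorem LogExpands.aeval_holD {f : FormalLog σ} {F : Hol V} (hf : LogExpands f F) (p : ℂ[X]) :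
    LogExpands (aeval (formalD σ) p f) (aeval (Hypergeom.holD V) p F) := by
  induction p using Polynomial.induction_on generalizing f F with
  | C c => simpa using hf.smul c
  | add p q hp hq => rw [map_add, map_add]; exact (hp hf).add (hq hf)
  | monomial k c ih =>
    rw [pow_succ, ← mul_assoc, map_mul (aeval (formalD σ)), map_mul (aeval (Hypergeom.holD V)),
      aeval_X, aeval_X]
    exact ih hf.holD

/-- The operator applied to F is the sum of the operator applied to f, which is the zero series, and
sums are unique. -/
theorem LogExpands.mem_holSolutions {f : FormalLog σ} {F : Hol V} (hf : LogExpands f F) {n : ℕ}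
    {α β : Fin n → ℂ} (h : f ∈ formalSolutions σ α β) : F ∈ holSolutions V α β := by
  have h1 := ((hf.aeval_holD (∏ i, (X - C (α i)))).smul ((-1) ^ n)).sub
    (hf.aeval_holD (∏ j, (X - C (β j)))).holZ
  change LogExpands (hypOp (formalD σ) (formalZ σ) α β f)
    (hypOp (Hypergeom.holD V) (Hypergeom.holZ V) α β F) at h1
  rw [LinearMap.mem_ker.1 h] at h1
  exact LinearMap.mem_ker.2 (h1.unique logExpands_zero)

theorem logTerm_formalDeck (f : FormalLog σ) (u a : ℂ) :
    logTerm (formalDeck σ 1 f) u a = logTerm f (u + twoPiI * (1 : ℤ)) a := by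
  change Complex.exp (a * u) * (Complex.exp (twoPiI * (1 : ℤ) * a) •
    (f.1 a).comp (X + C (twoPiI * (1 : ℤ)))).eval u = _
  rw [eval_smul, smul_eq_mul, eval_comp, ← mul_assoc, ← Complex.exp_add, logTerm]
  simp only [eval_add, eval_X, eval_C]
  congr 2
  ring

theorem LogExpands.holDeck_eq {f g : FormalLog σ} {F G : Hol V} (hf : LogExpands f F)
    (hg : LogExpands g G) (h : formalDeck σ 1 f = g) : holDeck V 1 F = G := by
  refine Hol.ext_on fun u hu => ?_
  have h1 := hf.hasSum _ ((logCover_add V 1 u).2 hu)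
  rw [← funext fun a => logTerm_formalDeck f u a, h] at h1
  exact h1.unique (hg.hasSum u hu)

open Classical in
theorem NormallyConvergent.exists_logExpands {f : FormalLog σ} (hf : NormallyConvergent V f) :
    ∃ F : Hol V, LogExpands f F := by
  let F : ℂ → ℂ := fun u => if u ∈ logCover V then ∑' a, logTerm f u a else 0
  have hF : ∀ u ∈ logCover V, F u = ∑' a, logTerm f u a := fun u hu => if_pos hu
  have hFmem : F ∈ Hol V := by
    refine ⟨fun u hu => ?_, fun u hu => if_neg hu⟩
    obtain ⟨U, hU, huU, hUV, B, hB, hfB⟩ := hf u hu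
    have h := Complex.differentiableOn_tsum_of_summable_norm (F := fun a w => logTerm f w a) hB
      (fun a => (differentiable_logTerm f a).differentiableOn) hU hfB
    refine DifferentiableAt.differentiableWithinAt ?_
    refine ((h u huU).differentiableAt (hU.mem_nhds huU)).congr_of_eventuallyEq ?_
    filter_upwards [hU.mem_nhds huU] with w hw
    exact hF w (hUV hw)
  refine ⟨⟨F, hFmem⟩, hf, fun u hu => ?_⟩
  obtain ⟨U, hU, huU, hUV, B, hB, hfB⟩ := hf u hu
  change HasSum _ (F u)
  rw [hF u hu]
  exact (Summable.of_norm_bounded hB fun a => hfB a u huU).hasSum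

end Expansion

/-! ### The formal series and its terms -/

variable {σ : ℤ} {n : ℕ} {α β x : Fin n → ℂ}

theorem injective_progression (hσ : σ = 1 ∨ σ = -1) (ν : ℂ) :
    Function.Injective fun l : ℕ => ν + (σ : ℂ) * l := by
  intro l m h
  rcases hσ with rfl | rfl <;> simpa using h

theorem logTerm_formalSeries (ν : ℂ) (r : ℕ) (u : ℂ) (l : ℕ) :
    logTerm (formalSeries σ α β ν r) u (ν + σ * l) = seriesTerm σ α β ν r u l := by
  classical
  have : (formalSeries σ α β ν r).1 (ν + σ * l) = logCoeff α β r (ν + σ * l) := if_pos ⟨l, rfl⟩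
  rw [logTerm, this, seriesTerm_eq]

theorem logTerm_formalSeries_eq_zero {ν : ℂ} (r : ℕ) (u : ℂ) {a : ℂ}
    (ha : a ∉ Set.range fun l : ℕ => ν + (σ : ℂ) * l) :
    logTerm (formalSeries σ α β ν r) u a = 0 := by
  classical
  have : (formalSeries σ α β ν r).1 a = 0 :=
    if_neg fun h => ha ⟨h.choose, h.choose_spec.symm⟩
  rw [logTerm, this, eval_zero, mul_zero]

theorem hasSum_logTerm_formalSeries (hσ : σ = 1 ∨ σ = -1) {ν : ℂ} {r : ℕ} {u s : ℂ} :
    HasSum (logTerm (formalSeries σ α β ν r) u) s ↔ HasSum (seriesTerm σ α β ν r u) s := by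
  rw [← (injective_progression hσ ν).hasSum_iff fun a ha => logTerm_formalSeries_eq_zero r u ha]
  rw [show logTerm (formalSeries σ α β ν r) u ∘ (fun l : ℕ => ν + (σ : ℂ) * l) =
    seriesTerm σ α β ν r u from funext fun l => logTerm_formalSeries ν r u l]

/-- The uniqueness theorem for power series, with the origin excluded from the hypothesis because z
= 0 is not on the cover. -/
theorem eq_zero_of_hasSum_zero {c : ℕ → ℂ} {δ : ℝ} (hδ : 0 < δ)
    (h : ∀ w : ℂ, w ≠ 0 → ‖w‖ < δ → HasSum (fun l => c l * w ^ l) 0) : c = 0 := by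
  -- The sum of the series on the whole disc, 0^0 = 1 giving the value c 0 at the origin. Continuity
  -- there forces c 0 = 0.
  let g : ℂ → ℂ := Function.update 0 0 (c 0)
  have hp : HasFPowerSeriesAt g (FormalMultilinearSeries.ofScalars ℂ c) 0 := by
    rw [hasFPowerSeriesAt_iff]
    filter_upwards [Metric.ball_mem_nhds 0 hδ] with w hw
    rw [zero_add]
    simp only [FormalMultilinearSeries.coeff_ofScalars, smul_eq_mul]
    rcases eq_or_ne w 0 with rfl | hw0
    · have : g 0 = (0 : ℂ) ^ 0 * c 0 := by simp [g]
      rw [this]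
      exact hasSum_single 0 fun l hl => by simp [hl]
    · have : g w = 0 := by simp [g, hw0]
      rw [this]
      simpa [mul_comm] using h w hw0 (by simpa using hw)
  have h0 : c 0 = 0 := by
    have h1 : Filter.Tendsto g (nhdsWithin 0 {0}ᶜ) (nhds (g 0)) :=
      hp.continuousAt.tendsto.mono_left nhdsWithin_le_nhds
    have h2 : Filter.Tendsto g (nhdsWithin 0 {0}ᶜ) (nhds 0) := by
      refine tendsto_const_nhds.congr' ?_
      filter_upwards [self_mem_nhdsWithin] with w hw
      simp only [Set.mem_compl_iff, Set.mem_singleton_iff] at hw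
      simp [g, hw]
    have := tendsto_nhds_unique h1 h2
    simpa [g] using this
  have hg : g = 0 := by
    funext w
    by_cases hw : w = 0 <;> simp [g, hw, h0]
  rw [hg] at hp
  have hz := hp.eq_zero
  funext l
  have := congrArg (fun p => FormalMultilinearSeries.coeff p l) hz
  simp only [FormalMultilinearSeries.coeff_ofScalars] at this
  rw [this]
  rfl

/-- For r = 0 there are no logarithms: divided by z^ν the sum is a power series in w = z^σ, one of
whose coefficients is nonzero. The point over w is u = σ log w, as σ² = 1. -/
theorem LogExpands.formalSeries_zero_ne_zero {ν : expValues x → ℂ} {V : Opens ℂ} {δ : ℝ}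
    (hσ : σ = 1 ∨ σ = -1) (hν : IsLocalExponent σ α β x ν) (hδ : 0 < δ)
    (hV : ∀ u, ‖Complex.exp (σ * u)‖ < δ → u ∈ logCover V) {A : expValues x} {F : Hol V}
    (hF : LogExpands (formalSeries σ α β (ν A) 0) F) : F ≠ 0 := by
  rintro rfl
  obtain ⟨l, hl⟩ := hν.exists_ne_zero A
  refine hl (congrFun (eq_zero_of_hasSum_zero (c := fun l => gammaProd α β (ν A + σ * l)) hδ
    fun w hw0 hw => ?_) l)
  have hσ2 : (σ : ℂ) * σ = 1 := by rcases hσ with rfl | rfl <;> simp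
  have hu : Complex.exp (σ * (σ * Complex.log w)) = w := by
    rw [← mul_assoc, hσ2, one_mul, Complex.exp_log hw0]
  have h := (hasSum_logTerm_formalSeries hσ).1
    (hF.hasSum (σ * Complex.log w) (hV _ (by rwa [hu])))
  have h' := h.mul_left (Complex.exp (-(ν A * (σ * Complex.log w))))
  change HasSum _ (_ * (0 : ℂ)) at h'
  rw [mul_zero] at h'
  convert h' using 2 with m
  rw [seriesTerm]
  simp only [pow_zero, one_mul, iteratedDeriv_zero]
  have hwm : w ^ m = Complex.exp (σ * (σ * Complex.log w)) ^ m := by rw [hu]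
  rw [hwm, ← Complex.exp_nat_mul, mul_left_comm (Complex.exp (-_)), ← Complex.exp_add, add_comm]
  congr 2
  ring

end

section

/-! ### Growth of the gamma product and convergence of the series -/

/-- A uniform form of the ratio test. -/
theorem exists_geometric_bound {n : ℕ} {g : ℕ → ℂ → ℂ} {X Y : Fin n → ℂ → ℂ} {K : Set ℂ} {c q : ℝ}
    (hK : IsCompact K) (hg : ∀ l, Continuous (g l)) (hX : ∀ i, ∀ t ∈ K, ‖X i t‖ ≤ c)
    (hY : ∀ i, ∀ t ∈ K, ‖Y i t‖ ≤ c)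
    (hrec : ∀ l t, ‖g (l + 1) t‖ * ∏ i, ‖(l : ℂ) + X i t‖ = ‖g l t‖ * ∏ i, ‖(l : ℂ) + Y i t‖)
    (hq : 1 < q) : ∃ C : ℝ, 0 ≤ C ∧ ∀ l, ∀ t ∈ K, ‖g l t‖ ≤ C * q ^ l := by
  -- The ratio is a product of n quotients; bounding each by q₀ bounds the ratio by q₀^n < q.
  obtain ⟨q₀, hq₀n, hq₀⟩ : ∃ q₀ : ℝ, q₀ ^ n < q ∧ 1 < q₀ := by
    have h : Filter.Tendsto (fun y : ℝ => y ^ n) (nhdsWithin 1 (Set.Ioi 1)) (nhds (1 ^ n)) :=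
      ((continuous_pow n).tendsto 1).mono_left nhdsWithin_le_nhds
    rw [one_pow] at h
    exact ((h.eventually_lt_const hq).and self_mem_nhdsWithin).exists
  -- Beyond L one has l > c and l + c < q₀(l - c), which is the bound on each quotient.
  obtain ⟨L, hL⟩ := exists_nat_gt (max c (c * (1 + q₀) / (q₀ - 1)))
  have hstep : ∀ l, L ≤ l → ∀ t ∈ K, ‖g (l + 1) t‖ ≤ q * ‖g l t‖ := fun l hl t ht => by
    have hlL : (L : ℝ) ≤ l := by exact_mod_cast hl
    have hc : c < l := ((le_max_left _ _).trans_lt hL).trans_le hlL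
    have hc' : c * (1 + q₀) < l * (q₀ - 1) :=
      (div_lt_iff₀ (sub_pos.2 hq₀)).1 (((le_max_right _ _).trans_lt hL).trans_le hlL)
    have hlow : ∀ i, (l : ℝ) - c ≤ ‖(l : ℂ) + X i t‖ := fun i => by
      have := norm_sub_norm_le (l : ℂ) (-X i t)
      rw [norm_neg, Complex.norm_natCast, sub_neg_eq_add] at this
      linarith [hX i t ht]
    have hpos : 0 < ∏ i, ‖(l : ℂ) + X i t‖ :=
      Finset.prod_pos fun i _ => (sub_pos.2 hc).trans_le (hlow i)
    have hratio : ∏ i, ‖(l : ℂ) + Y i t‖ ≤ q₀ ^ n * ∏ i, ‖(l : ℂ) + X i t‖ := by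
      have : q₀ ^ n * ∏ i, ‖(l : ℂ) + X i t‖ = ∏ i, (q₀ * ‖(l : ℂ) + X i t‖) := by
        rw [Finset.prod_mul_distrib]; simp
      rw [this]
      refine Finset.prod_le_prod (fun i _ => norm_nonneg _) fun i _ => ?_
      have h1 := norm_add_le (l : ℂ) (Y i t)
      rw [Complex.norm_natCast] at h1
      have h2 := mul_le_mul_of_nonneg_left (hlow i) (zero_le_one.trans hq₀.le)
      linarith [hY i t ht]
    refine le_of_mul_le_mul_right ?_ hpos
    rw [hrec]
    calc ‖g l t‖ * ∏ i, ‖(l : ℂ) + Y i t‖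
        ≤ ‖g l t‖ * (q₀ ^ n * ∏ i, ‖(l : ℂ) + X i t‖) :=
          mul_le_mul_of_nonneg_left hratio (norm_nonneg _)
      _ = q₀ ^ n * (‖g l t‖ * ∏ i, ‖(l : ℂ) + X i t‖) := by ring
      _ ≤ q * (‖g l t‖ * ∏ i, ‖(l : ℂ) + X i t‖) :=
          mul_le_mul_of_nonneg_right hq₀n.le (mul_nonneg (norm_nonneg _) hpos.le)
      _ = q * ‖g l t‖ * ∏ i, ‖(l : ℂ) + X i t‖ := by ring
  choose B hB using fun l => hK.exists_bound_of_continuousOn (hg l).continuousOn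
  have hsum : 0 ≤ ∑ l ∈ Finset.range (L + 1), |B l| := Finset.sum_nonneg fun _ _ => abs_nonneg _
  have hsmall : ∀ l, l ≤ L → ∀ t ∈ K,
      ‖g l t‖ ≤ (∑ l ∈ Finset.range (L + 1), |B l|) * q ^ l := fun l hl t ht =>
    calc ‖g l t‖ ≤ |B l| := (hB l t ht).trans (le_abs_self _)
      _ ≤ ∑ l ∈ Finset.range (L + 1), |B l| :=
        Finset.single_le_sum (f := fun l => |B l|) (fun _ _ => abs_nonneg _)
          (Finset.mem_range.2 (Nat.lt_succ_of_le hl))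
      _ ≤ _ := le_mul_of_one_le_right hsum (one_le_pow₀ hq.le)
  refine ⟨_, hsum, fun l t ht => ?_⟩
  rcases le_total l L with hl | hl
  · exact hsmall l hl t ht
  · induction l, hl using Nat.le_induction with
    | base => exact hsmall L le_rfl t ht
    | succ l hl ih =>
      refine (hstep l hl t ht).trans ?_
      rw [pow_succ]
      nlinarith

variable {σ : ℤ} {n : ℕ}

theorem norm_gammaProd_le (hσ : σ = 1 ∨ σ = -1) (α β : Fin n → ℂ) (ν : ℂ) {q : ℝ} (hq : 1 < q) :
    ∃ C : ℝ, 0 ≤ C ∧ ∀ l : ℕ, ∀ t ∈ Metric.sphere ν 1,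
      ‖gammaProd α β (σ * l + t)‖ ≤ C * q ^ l := by
  obtain ⟨M, hM⟩ := exists_nat_gt_norm_sub α 0
  obtain ⟨N, hN⟩ := exists_nat_gt_norm_sub β 0
  simp only [sub_zero] at hM hN
  have ht : ∀ t ∈ Metric.sphere ν 1, ‖t‖ ≤ ‖ν‖ + 1 := fun t ht => by
    rw [mem_sphere_iff_norm] at ht
    linarith [norm_le_norm_add_norm_sub' t ν, norm_sub_rev t ν]
  have hG := (gammaProd_differentiable α β).continuous
  have hM0 : (0 : ℝ) ≤ M := M.cast_nonneg
  have hN0 : (0 : ℝ) ≤ N := N.cast_nonneg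
  have hfun : ∀ s, (∏ i, ‖s - α i‖) * ‖gammaProd α β s‖ =
      (∏ j, ‖s - 1 - β j‖) * ‖gammaProd α β (s - 1)‖ := fun s => by
    have := congrArg norm (gammaProd_functional α β s)
    simpa [norm_mul, norm_prod] using this
  rcases hσ with rfl | rfl
  -- On the circle ‖t‖ ≤ ‖ν‖ + 1; the constant c adds 1 for the shift and M, N for the sizes of the
  -- α_i, β_i.
  · refine exists_geometric_bound (X := fun i t => t + 1 - α i) (Y := fun i t => t - β i)
      (c := ‖ν‖ + 2 + M + N) (isCompact_sphere ν 1) (fun l => by fun_prop) (fun i t h => ?_)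
      (fun i t h => ?_) (fun l t => ?_) hq
    · have := norm_sub_le (t + 1) (α i)
      have := norm_add_le t 1
      rw [norm_one] at this
      linarith [ht t h, hM i]
    · linarith [norm_sub_le t (β i), ht t h, hN i]
    · have := hfun (l + t + 1)
      rw [mul_comm, mul_comm ‖_‖]
      convert this using 2
      · exact Finset.prod_congr rfl fun i _ => by congr 1; ring
      · congr 2; push_cast; ring
      · exact Finset.prod_congr rfl fun i _ => by congr 1; ring
      · congr 2; push_cast; ring
  · refine exists_geometric_bound (X := fun i t => 1 + β i - t) (Y := fun i t => α i - t)
      (c := ‖ν‖ + 2 + M + N) (isCompact_sphere ν 1) (fun l => by fun_prop) (fun i t h => ?_)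
      (fun i t h => ?_) (fun l t => ?_) hq
    · have := norm_sub_le (1 + β i) t
      have := norm_add_le 1 (β i)
      rw [norm_one] at this
      linarith [ht t h, hN i]
    · linarith [norm_sub_le (α i) t, ht t h, hM i]
    · have := (hfun (-l + t)).symm
      rw [mul_comm, mul_comm ‖_‖]
      convert this using 2
      · exact Finset.prod_congr rfl fun i _ => by rw [← norm_neg]; congr 1; ring
      · congr 2; push_cast; ring
      · exact Finset.prod_congr rfl fun i _ => by rw [← norm_neg]; congr 1; ring
      · congr 2; push_cast; ring

/-- Cauchy's estimate for the r-th t-derivative on the unit circle around ν. There z^(σl)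
contributes at most exp(d)^l and z^t a factor independent of l. -/
theorem norm_seriesTerm_le {α β : Fin n → ℂ} {ν : ℂ} {C q : ℝ} {l : ℕ}
    (hC : ∀ t ∈ Metric.sphere ν 1, ‖gammaProd α β (σ * l + t)‖ ≤ C * q ^ l)
    (r : ℕ) {u : ℂ} {d M : ℝ} (hd : σ * u.re ≤ d) (hM : ‖u‖ ≤ M) (hCq : 0 ≤ C * q ^ l) :
    ‖seriesTerm σ α β ν r u l‖ ≤
      ‖twoPiI⁻¹‖ ^ r * r.factorial * C * Real.exp ((‖ν‖ + 1) * M) * (q * Real.exp d) ^ l := by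
  have hdiff : Differentiable ℂ fun t : ℂ =>
      gammaProd α β (σ * l + t) * Complex.exp ((σ * l + t) * u) :=
    ((gammaProd_differentiable α β).comp (by fun_prop : Differentiable ℂ fun t => (σ * l + t : ℂ))).fun_mul
      (by fun_prop)
  have hbound : ∀ t ∈ Metric.sphere ν 1,
      ‖gammaProd α β (σ * l + t) * Complex.exp ((σ * l + t) * u)‖ ≤
        C * q ^ l * (Real.exp d ^ l * Real.exp ((‖ν‖ + 1) * M)) := fun t ht => by
    rw [norm_mul]
    refine mul_le_mul (hC t ht) ?_ (norm_nonneg _) hCq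
    rw [Complex.norm_exp, ← Real.exp_nat_mul, ← Real.exp_add, Real.exp_le_exp, add_mul,
      Complex.add_re]
    refine add_le_add ?_ ?_
    · have : ((σ : ℂ) * l * u).re = l * (σ * u.re) := by
        rw [show (σ : ℂ) * l * u = ((σ * l : ℝ) : ℂ) * u by push_cast; ring, Complex.re_ofReal_mul]
        ring
      rw [this]
      exact mul_le_mul_of_nonneg_left hd l.cast_nonneg
    · refine (Complex.re_le_norm _).trans ?_
      rw [norm_mul]
      rw [mem_sphere_iff_norm] at ht
      exact mul_le_mul (by linarith [norm_le_norm_add_norm_sub' t ν, norm_sub_rev t ν]) hM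
        (norm_nonneg _) (by positivity)
  have h := Complex.norm_iteratedDeriv_le_of_forall_mem_sphere_norm_le r one_pos
    hdiff.diffContOnCl hbound
  rw [one_pow, div_one] at h
  rw [seriesTerm, norm_mul, norm_pow]
  refine (mul_le_mul_of_nonneg_left h (by positivity)).trans (le_of_eq ?_)
  rw [mul_pow]
  ring

theorem normallyConvergent_formalSeries (hσ : σ = 1 ∨ σ = -1) (α β : Fin n → ℂ) (ν : ℂ) (r : ℕ)
    {V : Opens ℂ} (hV : ∀ u ∈ logCover V, σ * u.re < 0) :
    NormallyConvergent V (formalSeries σ α β ν r) := by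
  intro u hu
  obtain ⟨d, hd, hd0⟩ := exists_between (hV u hu)
  -- The growth rate exp(-d/2) > 1 of 𝚪 against the decay exp(d) leaves a geometric series of ratio
  -- exp(d/2) < 1.
  obtain ⟨C, hC, hbound⟩ := norm_gammaProd_le hσ α β ν
    (q := Real.exp (-d / 2)) (by rw [Real.one_lt_exp_iff]; linarith)
  let b : ℕ → ℝ := fun l => ‖twoPiI⁻¹‖ ^ r * r.factorial * C *
    Real.exp ((‖ν‖ + 1) * (‖u‖ + 1)) * (Real.exp (-d / 2) * Real.exp d) ^ l
  have hb : Summable b := by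
    refine Summable.mul_left _ (summable_geometric_of_lt_one (by positivity) ?_)
    rw [← Real.exp_add, Real.exp_lt_one_iff]
    linarith
  have hinj := injective_progression hσ ν
  refine ⟨logCover V ∩ {w | (σ : ℝ) * w.re < d} ∩ {w | ‖w‖ < ‖u‖ + 1}, ?_, ⟨⟨hu, hd⟩, ?_⟩,
    fun w hw => hw.1.1, Function.extend (fun l : ℕ => ν + (σ : ℂ) * l) b 0, ?_, fun a w hw => ?_⟩
  · exact ((logCover V).2.inter (isOpen_lt (by fun_prop) continuous_const)).inter
      (isOpen_lt continuous_norm continuous_const)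
  · exact lt_add_one ‖u‖
  · exact ((hasSum_extend_zero hinj).2 hb.hasSum).summable
  · by_cases ha : a ∈ Set.range fun l : ℕ => ν + (σ : ℂ) * l
    · obtain ⟨l, rfl⟩ := ha
      rw [hinj.extend_apply, logTerm_formalSeries]
      exact norm_seriesTerm_le (hbound l) r (le_of_lt hw.1.2) (le_of_lt hw.2) (by positivity)
    · rw [logTerm_formalSeries_eq_zero r w ha, norm_zero, Function.extend_apply' _ _ _ ha]
      rfl

end

section

/-! ### The dimension of the space of holomorphic solutions -/

section Dimension

variable {V : Opens ℂ} {n : ℕ}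

theorem holD_holZ (F : Hol V) : holD V (holZ V F) = holZ V (F + holD V F) := by
  refine Hol.ext_on fun u hu => ?_
  have h1 : (holD V (holZ V F)).1 u = deriv (fun w => Complex.exp w * F.1 w) u := if_pos hu
  have h2 : (holD V F).1 u = deriv F.1 u := if_pos hu
  have h3 : (holZ V (F + holD V F)).1 u = Complex.exp u * (F.1 u + (holD V F).1 u) := rfl
  rw [h1, h3, h2, deriv_fun_mul Complex.differentiableAt_exp (Hol.differentiableAt F hu),
    Complex.deriv_exp]
  ring

/-- The commutation rule D z = z (D + 1), iterated. -/
theorem holD_pow_holZ (k : ℕ) (F : Hol V) :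
    (holD V ^ k) (holZ V F) = holZ V (aeval (holD V) ((X + 1 : ℂ[X]) ^ k) F) := by
  induction k generalizing F with
  | zero => simp
  | succ k ih =>
    rw [pow_succ, Module.End.mul_apply, holD_holZ, ih, pow_succ, map_mul, Module.End.mul_apply]
    congr 2
    simp [add_comm]

theorem holD_pow_apply (F : Hol V) (m : ℕ) {u : ℂ} (hu : u ∈ logCover V) :
    ((holD V ^ m) F).1 u = iteratedDeriv m F.1 u := by
  induction m generalizing u with
  | zero => simp
  | succ m ih =>
    rw [pow_succ', Module.End.mul_apply, iteratedDeriv_succ]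
    have h : (holD V ((holD V ^ m) F)).1 u = deriv ((holD V ^ m) F).1 u := if_pos hu
    rw [h]
    refine Filter.EventuallyEq.deriv_eq ?_
    filter_upwards [(logCover V).2.mem_nhds hu] with w hw using ih hw

theorem natDegree_prod_X_sub_C (x : Fin n → ℂ) : (∏ i, (X - C (x i))).natDegree = n := by
  simp

theorem coeff_pow_mul_prod {q : ℂ[X]} (hq : q.Monic) (hq1 : q.natDegree = 1) (k : ℕ)
    (x : Fin n → ℂ) :
    (q ^ k * ∏ i, (X - C (x i))).natDegree = n + k ∧
      (q ^ k * ∏ i, (X - C (x i))).coeff (n + k) = 1 := by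
  have hm : (∏ i, (X - C (x i))).Monic := monic_prod_of_monic _ _ fun i _ => monic_X_sub_C _
  have hd : (q ^ k * ∏ i, (X - C (x i))).natDegree = n + k := by
    rw [(hq.pow k).natDegree_mul hm, hq.natDegree_pow, hq1, natDegree_prod_X_sub_C]
    ring
  refine ⟨hd, ?_⟩
  have := ((hq.pow k).mul hm).coeff_natDegree
  rwa [hd] at this

/-- A functional on polynomials that vanishes on `1, …, X ^ (n - 1)` and on polynomials of every
degree `≥ n` is zero. -/
theorem functional_X_pow_eq_zero {φ : ℂ[X] →ₗ[ℂ] ℂ} (h0 : ∀ m < n, φ (X ^ m) = 0) {q : ℕ → ℂ[X]}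
    (hq : ∀ k, φ (q k) = 0) (hdeg : ∀ k, (q k).natDegree ≤ n + k)
    (hlead : ∀ k, (q k).coeff (n + k) ≠ 0) (m : ℕ) : φ (X ^ m) = 0 := by
  induction m using Nat.strong_induction_on with
  | _ m ih =>
    rcases lt_or_ge m n with hm | hm
    · exact h0 m hm
    · obtain ⟨k, rfl⟩ := Nat.exists_eq_add_of_le hm
      have h := hq k
      rw [as_sum_range_C_mul_X_pow' (q k) (Nat.lt_succ_of_le (hdeg k)), map_sum,
        Finset.sum_range_succ, Finset.sum_eq_zero fun j hj => ?_, zero_add, ← smul_eq_C_mul,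
        map_smul, smul_eq_mul] at h
      · exact (mul_eq_zero.1 h).resolve_left (hlead k)
      · rw [← smul_eq_C_mul, map_smul, ih j (Finset.mem_range.1 hj), smul_zero]

/-- Evaluation of the derivatives of a function on `logCover V` at the point `u`. -/
def jetFunctional (F : Hol V) (u : ℂ) : ℂ[X] →ₗ[ℂ] ℂ where
  toFun p := (aeval (holD V) p F).1 u
  map_add' p q := by simp
  map_smul' c p := by simp

theorem jetFunctional_eq_zero {α β : Fin n → ℂ} {F : Hol V} (hF : F ∈ holSolutions V α β) {u : ℂ}
    (hlead : (-1) ^ n - Complex.exp u ≠ 0)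
    (h0 : ∀ m < n, jetFunctional F u (X ^ m) = 0) (m : ℕ) : jetFunctional F u (X ^ m) = 0 := by
  have hX1 : (X + 1 : ℂ[X]).natDegree = 1 := natDegree_X_add_C 1
  -- Applying D^k to the equation and evaluating at u gives a relation among derivatives of order at
  -- most n + k, with top coefficient (-1)^n - exp u.
  refine functional_X_pow_eq_zero h0 (q := fun k => (-1 : ℂ) ^ n • (X ^ k * ∏ i, (X - C (α i))) -
    Complex.exp u • ((X + 1) ^ k * ∏ j, (X - C (β j)))) (fun k => ?_) (fun k => ?_) (fun k => ?_) m
  · have h := congrArg (fun G => ((holD V ^ k) G).1 u) (LinearMap.mem_ker.1 hF)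
    have e : hypOp (holD V) (holZ V) α β F = (-1 : ℂ) ^ n • aeval (holD V) (∏ i, (X - C (α i))) F -
      holZ V (aeval (holD V) (∏ j, (X - C (β j))) F) := rfl
    simp only [e, map_sub, map_smul, map_zero, holD_pow_holZ] at h
    rw [map_sub, map_smul, map_smul]
    change (-1 : ℂ) ^ n • (aeval (holD V) (X ^ k * ∏ i, (X - C (α i))) F).1 u - Complex.exp u •
      (aeval (holD V) ((X + 1) ^ k * ∏ j, (X - C (β j))) F).1 u = 0
    rw [map_mul, map_mul, Module.End.mul_apply, Module.End.mul_apply, map_pow, aeval_X]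
    exact h
  · refine (natDegree_sub_le _ _).trans (max_le ?_ ?_) <;> refine (natDegree_smul_le _ _).trans ?_
    · exact (coeff_pow_mul_prod monic_X natDegree_X k α).1.le
    · exact (coeff_pow_mul_prod (monic_X_add_C 1) hX1 k β).1.le
  · have h1 := (coeff_pow_mul_prod monic_X natDegree_X k α).2
    have h2 := (coeff_pow_mul_prod (monic_X_add_C 1) hX1 k β).2
    rw [C_1] at h2
    simp only [coeff_sub, coeff_smul, h1, h2, smul_eq_mul, mul_one]
    exact hlead

theorem Hol.eq_zero_of_jet (hconn : IsPreconnected (logCover V : Set ℂ)) {F : Hol V} {u : ℂ}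
    (hu : u ∈ logCover V) (h : ∀ m, jetFunctional F u (X ^ m) = 0) : F = 0 := by
  have han : AnalyticOnNhd ℂ F.1 (logCover V) := F.2.1.analyticOnNhd (logCover V).2
  have hord : analyticOrderAt F.1 u = ⊤ := by
    rw [ENat.eq_top_iff_forall_ge]
    refine fun m => (natCast_le_analyticOrderAt_iff_iteratedDeriv_eq_zero (han u hu)).2 fun i _ => ?_
    rw [← holD_pow_apply F i hu, ← h i]
    change _ = (aeval (holD V) (X ^ i) F).1 u
    rw [map_pow, aeval_X]
  have := han.eqOn_zero_of_preconnected_of_eventuallyEq_zero hconn hu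
    (analyticOrderAt_eq_top.1 hord)
  exact Hol.ext_on fun w hw => this hw

/-- At a point that is not singular, the first n derivatives determine all the others, and the
identity theorem determines F. -/
theorem finrank_holSolutions (hconn : IsPreconnected (logCover V : Set ℂ)) {u : ℂ}
    (hu : u ∈ logCover V) (hlead : (-1) ^ n - Complex.exp u ≠ 0) (α β : Fin n → ℂ) :
    Module.Finite ℂ (holSolutions V α β) ∧ Module.finrank ℂ (holSolutions V α β) ≤ n := by
  let Ψ : holSolutions V α β →ₗ[ℂ] (Fin n → ℂ) :=
    { toFun := fun F m => jetFunctional F.1 u (X ^ (m : ℕ))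
      map_add' := fun F G => by funext m; simp [jetFunctional]
      map_smul' := fun c F => by funext m; simp [jetFunctional] }
  have hinj : Function.Injective Ψ := by
    rw [injective_iff_map_eq_zero]
    exact fun F hF => Subtype.ext (Hol.eq_zero_of_jet hconn hu
      (jetFunctional_eq_zero F.2 hlead fun m hm => congrFun hF ⟨m, hm⟩))
  refine ⟨Module.Finite.of_injective Ψ hinj, ?_⟩
  have := LinearMap.finrank_le_finrank_of_injective hinj
  rwa [Module.finrank_fin_fun] at this

end Dimension

/-! ### Holomorphic bases -/

variable {σ : ℤ} {n : ℕ} {α β x : Fin n → ℂ} {ν : expValues x → ℂ}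

theorem exists_hol_basis {V : Opens ℂ} {δ : ℝ} (hσ : σ = 1 ∨ σ = -1)
    (hν : IsLocalExponent σ α β x ν) (hδ : 0 < δ)
    (hVδ : ∀ u, ‖Complex.exp (σ * u)‖ < δ → u ∈ logCover V)
    (hV : ∀ u ∈ logCover V, σ * u.re < 0)
    (hconn : IsPreconnected (logCover V : Set ℂ)) :
    ∃ b : Module.Basis (LocalIndex x) ℂ (holSolutions V α β),
      (∀ i, ∀ u ∈ logCover V,
        HasSum (seriesTerm σ α β (ν i.1) (i.2 : ℕ) u) ((b i : Hol V).1 u)) ∧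
      LinearMap.toMatrix b b (holMonodromy V 1 α β) = (blockD x).transpose := by
  choose F hF using fun q : LocalIndex x =>
    (normallyConvergent_formalSeries hσ α β (ν q.1) q.2 hV).exists_logExpands
  obtain ⟨u, hu⟩ : ∃ u, u ∈ logCover V := by
    refine ⟨σ * Real.log (δ / 2), hVδ _ ?_⟩
    have hσ2 : (σ : ℂ) * σ = 1 := by rcases hσ with rfl | rfl <;> simp
    rw [← mul_assoc, hσ2, one_mul, Complex.norm_exp, Complex.ofReal_re, Real.exp_log (by linarith)]
    linarith
  -- A zero of the leading coefficient would have |z| = 1, that is u.re = 0, which the cover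
  -- excludes.
  have hlead : (-1) ^ n - Complex.exp u ≠ 0 := fun h => by
    have h1 := congrArg norm (sub_eq_zero.1 h)
    rw [norm_pow, norm_neg, norm_one, one_pow, Complex.norm_exp, eq_comm, Real.exp_eq_one_iff] at h1
    have h2 := hV u hu
    rw [h1, mul_zero] at h2
    exact lt_irrefl _ h2
  have hfin := finrank_holSolutions hconn hu hlead α β
  have := hfin.1
  let S : LocalIndex x → holSolutions V α β :=
    fun q => ⟨F q, (hF q).mem_holSolutions (formalSeries_mem hσ hν q.2.2)⟩
  have hT : ∀ q, holMonodromy V 1 α β (S q) = ∑ p, blockD x q p • S p := fun q => Subtype.ext <| by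
    rw [Submodule.coe_sum]
    exact (hF q).holDeck_eq (LogExpands.sum _ fun p => (hF p).smul (blockD x q p))
      (formalDeck_formalSeries hσ hν q)
  obtain ⟨b, hb, hM⟩ := exists_basis_of_blockD hfin.2 (holMonodromy V 1 α β) S hT
    fun A h h0 => (hF ⟨A, ⟨0, h⟩⟩).formalSeries_zero_ne_zero hσ hν hδ hVδ (congrArg Subtype.val h0)
  refine ⟨b, fun i u hu => ?_, hM⟩
  rw [hb]
  exact (hasSum_logTerm_formalSeries hσ).1 ((hF i).hasSum u hu)

/-! ### Inverse turns and the covers of the two punctured discs -/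

theorem holDeck_neg_mul (V : Opens ℂ) (k : ℤ) : holDeck V (-k) * holDeck V k = 1 := by
  refine LinearMap.ext fun f => Subtype.ext (funext fun u => ?_)
  change f.1 (u + twoPiI * (-k : ℤ) + twoPiI * k) = f.1 u
  have : u + twoPiI * (-k : ℤ) + twoPiI * k = u := by push_cast; ring
  rw [this]

theorem toMatrix_restrict_inv {ι M : Type*} [Fintype ι] [DecidableEq ι] [AddCommGroup M]
    [Module ℂ M] {W : Submodule ℂ M} (b : Module.Basis ι ℂ W) {S T : Module.End ℂ M}
    (hS : ∀ w ∈ W, S w ∈ W) (hT : ∀ w ∈ W, T w ∈ W) (h : S * T = 1) :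
    LinearMap.toMatrix b b (S.restrict hS) = (LinearMap.toMatrix b b (T.restrict hT))⁻¹ := by
  refine (Matrix.inv_eq_left_inv ?_).symm
  rw [← LinearMap.toMatrix_mul, ← LinearMap.toMatrix_one b]
  congr 1
  exact LinearMap.ext fun w => Subtype.ext (LinearMap.congr_fun h w.1)

theorem mem_logCover_discZero {ρ : ℝ} {u : ℂ} :
    u ∈ logCover (discZero ρ) ↔ Real.exp u.re < ρ := by
  change 0 < ‖Complex.exp u‖ ∧ ‖Complex.exp u‖ < ρ ↔ _
  rw [Complex.norm_exp]
  exact and_iff_right (Real.exp_pos _)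

theorem mem_logCover_discInfty {R : ℝ} {u : ℂ} :
    u ∈ logCover (discInfty R) ↔ R < Real.exp u.re := by
  change R < ‖Complex.exp u‖ ↔ _
  rw [Complex.norm_exp]

theorem isPreconnected_logCover_discZero {ρ : ℝ} (hρ : 0 < ρ) :
    IsPreconnected (logCover (discZero ρ) : Set ℂ) := by
  have : (logCover (discZero ρ) : Set ℂ) = {u | u.re < Real.log ρ} := Set.ext fun u => by
    rw [Set.mem_ofPred_eq, Real.lt_log_iff_exp_lt hρ]
    exact mem_logCover_discZero
  rw [this]
  exact (convex_halfSpace_re_lt _).isPreconnected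

theorem isPreconnected_logCover_discInfty {R : ℝ} (hR : 0 < R) :
    IsPreconnected (logCover (discInfty R) : Set ℂ) := by
  have : (logCover (discInfty R) : Set ℂ) = {u | Real.log R < u.re} := Set.ext fun u => by
    rw [Set.mem_ofPred_eq, Real.log_lt_iff_lt_exp hR]
    exact mem_logCover_discInfty
  rw [this]
  exact (convex_halfSpace_re_gt _).isPreconnected

end

end Hypergeom

end

theorem mainTheorem9 {n : ℕ} (α β : Fin n → ℂ)
    (hαβ : ∀ (i j : Fin n) (k : ℤ), α i ≠ β j + (k : ℂ)) :
    -- formal solutions at 0 and their monodromy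
    (∃ b : Module.Basis (Hypergeom.LocalIndex α) ℂ (Hypergeom.formalSolutions 1 α β),
      (∀ i, (b i : Hypergeom.FormalLog 1) =
        Hypergeom.formalSeries 1 α β (Hypergeom.nuMin α i.1) (i.2 : ℕ)) ∧
      LinearMap.toMatrix b b (Hypergeom.formalMonodromy 1 α β) =
        (Hypergeom.blockD α).transpose) ∧
    -- the series converge for 0 < |z| < 1; analytic solutions near 0 and their monodromy
    (∀ ρ : ℝ, 0 < ρ → ρ ≤ 1 →
      ∃ b : Module.Basis (Hypergeom.LocalIndex α) ℂ
          (Hypergeom.holSolutions (Hypergeom.discZero ρ) α β),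
        (∀ i, ∀ u ∈ Hypergeom.logCover (Hypergeom.discZero ρ),
          HasSum (Hypergeom.seriesTerm 1 α β (Hypergeom.nuMin α i.1) (i.2 : ℕ) u)
            ((b i : Hypergeom.Hol (Hypergeom.discZero ρ)).1 u)) ∧
        LinearMap.toMatrix b b (Hypergeom.holMonodromy (Hypergeom.discZero ρ) 1 α β) =
          (Hypergeom.blockD α).transpose) ∧
    -- formal solutions at infinity and their monodromy
    (∃ b : Module.Basis (Hypergeom.LocalIndex β) ℂ (Hypergeom.formalSolutions (-1) α β),
      (∀ i, (b i : Hypergeom.FormalLog (-1)) =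
        Hypergeom.formalSeries (-1) α β (Hypergeom.nuMax β i.1) (i.2 : ℕ)) ∧
      LinearMap.toMatrix b b (Hypergeom.formalMonodromy (-1) α β) =
        (Hypergeom.blockD β).transpose⁻¹) ∧
    -- the series converge for |z| > 1; analytic solutions near infinity and their monodromy,
    -- a positive turn around infinity being a negative turn around 0
    (∀ R : ℝ, 1 ≤ R →
      ∃ b : Module.Basis (Hypergeom.LocalIndex β) ℂ
          (Hypergeom.holSolutions (Hypergeom.discInfty R) α β),
        (∀ i, ∀ u ∈ Hypergeom.logCover (Hypergeom.discInfty R),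
          HasSum (Hypergeom.seriesTerm (-1) α β (Hypergeom.nuMax β i.1) (i.2 : ℕ) u)
            ((b i : Hypergeom.Hol (Hypergeom.discInfty R)).1 u)) ∧
        LinearMap.toMatrix b b (Hypergeom.holMonodromy (Hypergeom.discInfty R) (-1) α β) =
          (Hypergeom.blockD β).transpose⁻¹) := by
  have h0 := Hypergeom.isLocalExponent_zero hαβ
  have h1 := Hypergeom.isLocalExponent_infty hαβ
  refine ⟨Hypergeom.exists_formal_basis (Or.inl rfl) h0
    (Hypergeom.finrank_formalSolutions_zero hαβ), fun ρ hρ hρ1 => ?_, ?_, fun R hR => ?_⟩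
  · refine Hypergeom.exists_hol_basis (Or.inl rfl) h0 hρ (fun u hu => ?_) (fun u hu => ?_)
      (Hypergeom.isPreconnected_logCover_discZero hρ)
    · rw [Int.cast_one, one_mul, Complex.norm_exp] at hu
      exact Hypergeom.mem_logCover_discZero.2 hu
    · rw [Int.cast_one, one_mul, ← Real.exp_lt_one_iff]
      exact (Hypergeom.mem_logCover_discZero.1 hu).trans_le hρ1
  · obtain ⟨b, hb, hM⟩ := Hypergeom.exists_formal_basis (Or.inr rfl) h1
      (Hypergeom.finrank_formalSolutions_infty hαβ)
    refine ⟨b, hb, ?_⟩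
    rw [← hM]
    -- The basis is unchanged: one positive turn around ∞ undoes one positive turn around 0, whose
    -- matrix is known.
    exact Hypergeom.toMatrix_restrict_inv b _ _ (Hypergeom.formalDeck_neg_mul (-1) 1)
  · have hR0 : 0 < R := one_pos.trans_le hR
    -- In the coordinate 1/z the neighbourhood |z| > R of ∞ is the disc of radius R⁻¹.
    have hnear : ∀ u : ℂ, ‖Complex.exp ((-1 : ℤ) * u)‖ < R⁻¹ →
        u ∈ Hypergeom.logCover (Hypergeom.discInfty R) := fun u hu => by
      rw [Int.cast_neg, Int.cast_one, neg_one_mul, Complex.norm_exp, Complex.neg_re, Real.exp_neg,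
        inv_lt_inv₀ (Real.exp_pos _) hR0] at hu
      exact Hypergeom.mem_logCover_discInfty.2 hu
    have hneg : ∀ u ∈ Hypergeom.logCover (Hypergeom.discInfty R), ((-1 : ℤ) : ℝ) * u.re < 0 :=
      fun u hu => by
        have := hR.trans_lt (Hypergeom.mem_logCover_discInfty.1 hu)
        rw [Real.one_lt_exp_iff] at this
        simpa using this
    obtain ⟨b, hb, hM⟩ := Hypergeom.exists_hol_basis (Or.inr rfl) h1 (inv_pos.2 hR0) hnear hneg
      (Hypergeom.isPreconnected_logCover_discInfty hR0)
    refine ⟨b, hb, ?_⟩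
    rw [← hM]
    exact Hypergeom.toMatrix_restrict_inv b _ _ (Hypergeom.holDeck_neg_mul _ 1)
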